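/- Let $(E,\mathcal E,\mu)$ be a complete probability space and $\mathcal H$ a separable real Hilbert space with its Borel $\sigma$-algebra. Let $A:E\times\mathcal H\to 2^{\mathcal H}$ be such that $A(s,\cdot)$ is maximal monotone for $\mu$-almost every $s$, and for $\lambda>0$ let $J_\lambda(s,x)=(I+\lambda A(s,\cdot))^{-1}(x)$ be the resolvent; assume that $J_\lambda(\cdot,x)$ is measurable for all $\lambda>0$ and $x\in\mathcal H$. Write $D_s=\{x: A(s,x)\neq\emptyset\}$, let $\mathcal D$ be the essential intersection of the $D_s$ (the set of $x$ such that $x\in D_s$ for $\mu$-almost every $s$), let $\Pi(s,\cdot)$ be the projection onto $\mathrm{cl}(D_s)$, and let $A_0(s,x)$ be the element of least norm of $A(s,x)$ for $x\in D_s$. A measurable selection of $A(\cdot,x)$ is a measurable $\phi:E\to\mathcal H$ with $\phi(s)\in A(s,x)$ for $\mu$-almost every $s$. The mean operator is the Aumann expectation $$\underline A(x)=\Big\{\int\phi\,d\mu:\ \phi \text{ an integrable measurable selection of } A(\cdot,x)\Big\},$$ $\mathrm{zer}(\underline A)=\{x: 0\in\underline A(x)\}$, and for $q\ge 1$, $\mathcal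 Z_A(q)$ is the set of $x$ for which $A(\cdot,x)$ has a measurable selection $\phi$ with $\int\|\phi\|^q\,d\mu<\infty$ and $\int\phi\,d\mu=0$. Let $(\lambda_n)_{n\ge0}$ be positive reals with $\sum_n\lambda_n^2<\infty$, $\sum_n\lambda_n=\infty$ and $\lambda_n/\lambda_{n+1}\to1$. On a probability space $(\Omega,\mathcal F,\mathbb P)$ let $(\xi_n)_{n\ge1}$ be independent $E$-valued random variables with law $\mu$; fix $x_0\in\mathcal H$ and set $$x_{n+1}=J_{\lambda_n}(\xi_{n+1},x_n)\quad(n\ge0),\qquad \overline x_n=\frac{\sum_{k=1}^n\lambda_kx_k}{\sum_{k=1}^n\lambda_k}\quad(n\ge1).$$ Assume: 1. $\underline A$ is maximal monotone; 2. $\mathrm{zer}(\underline A)\neq\emptyset$ and $\mathrm{zer}(\underline A)\subset\mathcal Z_A(2)$; 3. for every bounded $K\subset\mathcal H$ the family $(\|A_0(\cdot,x)\|: x\in K\cap\mathcal D)$ is uniformly integrable with respect to $\mu$; 4. for every $M>0$ there is $\kappa_M>0$ such that $\int d(x,D_s)^2\,d\mu(s)\ge\kappa_M\,d(x,\mathcal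 D)^2$ for all $x\in\mathcal H$ with $\|x\|\le M$; 5. there are an integer $p\ge1$ and a function $C\in L^2(E,\mathbb R_+,\mu)$ such that, for all $x\in\mathcal H$ and $\lambda>0$, $\|J_\lambda(s,x)-\Pi(s,x)\|\le\lambda\,C(s)\,(1+\|x\|^p)$ for $\mu$-almost every $s$, and $\mathcal Z_A(2p)\neq\emptyset$. Then, almost surely, $(\overline x_n)$ converges weakly to a zero of $\underline A$ (which may depend on $\omega\in\Omega$). -/

import Mathlib

open MeasureTheory ProbabilityTheory Filter Topology
open scoped ENNReal

namespace StochProx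

noncomputable section

section Operators

variable {H : Type*} [NormedAddCommGroup H] [InnerProductSpace ℝ H]

/-- A set-valued operator `T : H → 2^H` is monotone if `⟪y - y', x - x'⟫ ≥ 0` for all
`(x, y)` and `(x', y')` in its graph. -/
def IsMonotoneOp (T : H → Set H) : Prop :=
  ∀ x y x' y', y ∈ T x → y' ∈ T x' → 0 ≤ inner ℝ (y - y') (x - x')

/-- A monotone operator is maximal if its graph is not strictly contained in the graph of
another monotone operator. -/
def IsMaximalMonotoneOp (T : H → Set H) : Prop :=
  IsMonotoneOp T ∧ ∀ T' : H → Set H, IsMonotoneOp T' → (∀ x, T x ⊆ T' x) → T = T'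

/-- The domain of a set-valued operator. -/
def opDom (T : H → Set H) : Set H := {x | (T x).Nonempty}

/-- The zeroes of a set-valued operator. -/
def zer (T : H → Set H) : Set H := {x | (0 : H) ∈ T x}

/-- The set `(I + l T)⁻¹ x` of all `y` with `(x - y) / l ∈ T y`. -/
def resolventSet (T : H → Set H) (l : ℝ) (x : H) : Set H :=
  {y | l⁻¹ • (x - y) ∈ T y}

/-- The resolvent `(I + l T)⁻¹` as a point-valued map: the element of `resolventSet T l x`,
which is unique when `T` is maximal monotone and `l > 0` (unspecified if the set is empty). -/
def resolvent (T : H → Set H) (l : ℝ) (x : H) : H :=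
  Classical.epsilon fun y => y ∈ resolventSet T l x

/-- The metric projection of `x` onto `C`: the point of `C` nearest to `x`, which exists and is
unique when `C` is nonempty, closed and convex in a Hilbert space (unspecified if there is
no nearest point). -/
def proj (C : Set H) (x : H) : H :=
  Classical.epsilon fun y => y ∈ C ∧ ∀ z ∈ C, ‖x - y‖ ≤ ‖x - z‖

/-- The element of least norm of `T x`. -/
def leastNorm (T : H → Set H) (x : H) : H := proj (T x) 0

/-- The weighted averages `(∑_{k=1}^n l_k a_k) / (∑_{k=1}^n l_k)`. -/
def weightedAvg (l : ℕ → ℝ) (a : ℕ → H) (n : ℕ) : H :=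
  (∑ k ∈ Finset.Icc 1 n, l k)⁻¹ • ∑ k ∈ Finset.Icc 1 n, l k • a k

end Operators

section RandomOperators

variable {E : Type*} [MeasurableSpace E]
variable {H : Type*} [NormedAddCommGroup H] [InnerProductSpace ℝ H] [MeasurableSpace H]

/-- `φ` is a measurable selection of the multifunction `G` (up to `μ`-null sets). -/
def IsMeasurableSelection (μ : Measure E) (G : E → Set H) (φ : E → H) : Prop :=
  Measurable φ ∧ ∀ᵐ s ∂μ, φ s ∈ G s

/-- The Aumann integral of a multifunction: the set of Bochner integrals of its integrable
measurable selections. -/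
def aumannIntegral (μ : Measure E) (G : E → Set H) : Set H :=
  {v | ∃ φ : E → H, IsMeasurableSelection μ G φ ∧ Integrable φ μ ∧ ∫ s, φ s ∂μ = v}

/-- The mean operator `x ↦ ∫ A(s, x) dμ(s)` (Aumann integral). -/
def meanOp (μ : Measure E) (A : E → H → Set H) (x : H) : Set H :=
  aumannIntegral μ fun s => A s x

/-- The points `x` such that `A(·, x)` has a `q`-integrable measurable selection
with zero mean (used for `1 ≤ q < ∞`). -/
def zeroMeanSet (μ : Measure E) (A : E → H → Set H) (q : ℝ≥0∞) : Set H :=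
  {x | ∃ φ : E → H, IsMeasurableSelection μ (fun s => A s x) φ ∧ MemLp φ q μ ∧
    ∫ s, φ s ∂μ = 0}

/-- The essential intersection of the domains: the points that belong to the domain of
`A(s, ·)` for every `s` outside a `μ`-negligible set. -/
def essDom (μ : Measure E) (A : E → H → Set H) : Set H :=
  {x | ∀ᵐ s ∂μ, x ∈ opDom (A s)}

/-- The stochastic proximal point iterates `x₀`, `x_{n+1} = J_{l_n}(ξ_{n+1}, x_n)`. -/
def proxIter {Ω : Type*} (A : E → H → Set H) (l : ℕ → ℝ) (ξ : ℕ → Ω → E) (x₀ : H) :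
    ℕ → Ω → H
  | 0, _ => x₀
  | n + 1, ω => resolvent (A (ξ (n + 1) ω)) (l n) (proxIter A l ξ x₀ n ω)

end RandomOperators

end

end StochProx

/-! For every selection φ of A(·, y), a step satisfies ‖x_{n+1} - y‖² ≤ ‖x_n - y‖² - 2λ_n⟪φ, x_n -
y⟫ + λ_n²‖φ‖², with φ taken at ξ_{n+1} (`norm_resolvent_sub_sq_le`). Two uses of this inequality
feed an ergodic version of Opial's argument.

If y is a zero, φ can be chosen centred and square integrable. The inner products are then
martingale increments and the last terms are summable, so ‖x_n - y‖ converges almost surely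
(`ae_tendsto_norm_sub`).

For a general point (y, v) of the graph of the mean operator, φ is merely integrable with mean v, so
λ_n²‖φ‖² need not be summable. The inequality is kept where ‖φ‖ ≤ c. On B = {‖φ‖ > c} it is replaced
by the bound d(x_n, 𝒟) + λ_n C (1 + ‖x_n‖^p) on the displacement. Linear regularity makes a step
contract the mean square distance to 𝒟 up to O(λ_n²), whence ∑ d(x_k, 𝒟) = O(∑ λ_k) on bounded
trajectories (`sum_infDist_le`). The cost of B is thus a multiple of ∑ λ_k that vanishes as c → ∞,
and the weighted averages of ⟪v, x_k - y⟫ have nonpositive upper limit (`sum_inner_le`).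

By maximality every weak cluster point of the averages is a zero, and convergence of the distances
to the zeros leaves only one (`exists_tendsto_weightedAvg`). Countable dense subsets of the zeros
and of the graph keep the exceptional sets null. -/

namespace StochProx

/-! ### Weak compactness and the finite Debrunner–Flor property -/

section Hilbert

variable {H : Type*} [NormedAddCommGroup H] [InnerProductSpace ℝ H]

/-- A bounded family in a Hilbert space converges weakly along every ultrafilter. -/
theorem exists_weakLimit_of_bounded [CompleteSpace H] {ι : Type*} (U : Ultrafilter ι)
    (f : ι → H) (R : ℝ) (hf : ∀ᶠ i in U, ‖f i‖ ≤ R) :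
    ∃ z : H, ∀ y : H, Tendsto (fun i => inner ℝ (f i) y) U (𝓝 (inner ℝ z y)) := by
  have hb : ∀ y : H, ∃ a ∈ Set.Icc (-(R * ‖y‖)) (R * ‖y‖),
      Tendsto (fun i => inner ℝ (f i) y) U (𝓝 a) := by
    intro y
    have h1 : ∀ᶠ i in U, inner ℝ (f i) y ∈ Set.Icc (-(R * ‖y‖)) (R * ‖y‖) := by
      filter_upwards [hf] with i hi
      have := abs_real_inner_le_norm (f i) y
      have h2 : ‖f i‖ * ‖y‖ ≤ R * ‖y‖ := by gcongr
      exact abs_le.mp (this.trans h2)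
    exact isCompact_Icc.ultrafilter_le_nhds' (U.map fun i => inner ℝ (f i) y) h1
  choose a ha hta using hb
  -- The limits depend linearly on `y` with norm at most `R`; Riesz representation supplies the weak
  -- limit.
  let L : H →ₗ[ℝ] ℝ :=
    { toFun := a
      map_add' := fun x y => by
        refine tendsto_nhds_unique (hta (x + y)) ?_
        simpa only [inner_add_right] using (hta x).add (hta y)
      map_smul' := fun c x => by
        refine tendsto_nhds_unique (hta (c • x)) ?_
        simpa only [real_inner_smul_right, smul_eq_mul, RingHom.id_apply] using
          (hta x).const_mul c }
  let L' : H →L[ℝ] ℝ := L.mkContinuous R fun y => abs_le.mpr (ha y)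
  refine ⟨(InnerProductSpace.toDual ℝ H).symm L', fun y => ?_⟩
  rw [InnerProductSpace.toDual_symm_apply]
  exact hta y

/-- Since the weights sum to 1, the double sum of α_i α_j ⟪a_i - a_j, u_i - u_j⟫ is twice the
difference of the two sides. -/
theorem sum_inner_le_inner_sum {ι : Type*} [Fintype ι] (a u : ι → H)
    (h : ∀ i j, inner ℝ (a i - a j) (u i - u j) ≤ 0) (α : ι → ℝ) (hα : ∀ i, 0 ≤ α i)
    (hα1 : ∑ i, α i = 1) :
    ∑ i, α i * inner ℝ (a i) (u i) ≤ inner ℝ (∑ i, α i • a i) (∑ i, α i • u i) := by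
  have h0 : ∑ i, ∑ j, α i * α j * inner ℝ (a i - a j) (u i - u j) ≤ 0 :=
    Finset.sum_nonpos fun i _ => Finset.sum_nonpos fun j _ =>
      mul_nonpos_of_nonneg_of_nonpos (mul_nonneg (hα i) (hα j)) (h i j)
  have e1 : ∑ i, ∑ j, α i * α j * inner ℝ (a i) (u i) = ∑ i, α i * inner ℝ (a i) (u i) := by
    refine Finset.sum_congr rfl fun i _ => ?_
    have : ∀ j, α i * α j * inner ℝ (a i) (u i) = α j * (α i * inner ℝ (a i) (u i)) :=
      fun j => by ring
    simp only [this]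
    rw [← Finset.sum_mul, hα1, one_mul]
  have e2 : ∑ i, ∑ j, α i * α j * inner ℝ (a j) (u j) = ∑ i, α i * inner ℝ (a i) (u i) := by
    rw [Finset.sum_comm, ← e1]
    exact Finset.sum_congr rfl fun i _ => Finset.sum_congr rfl fun j _ => by ring
  have e3 : ∑ i, ∑ j, α i * α j * inner ℝ (a i) (u j)
      = inner ℝ (∑ i, α i • a i) (∑ i, α i • u i) := by
    simp only [sum_inner, inner_sum, real_inner_smul_left, real_inner_smul_right]
    rw [Finset.sum_comm]
    exact Finset.sum_congr rfl fun i _ => Finset.sum_congr rfl fun j _ => by ring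
  have e4 : ∑ i, ∑ j, α i * α j * inner ℝ (a j) (u i)
      = inner ℝ (∑ i, α i • a i) (∑ i, α i • u i) := by
    rw [← e3, Finset.sum_comm]
    exact Finset.sum_congr rfl fun i _ => Finset.sum_congr rfl fun j _ => by ring
  have e5 : ∑ i, ∑ j, α i * α j * inner ℝ (a i - a j) (u i - u j)
      = ∑ i, ∑ j, α i * α j * inner ℝ (a i) (u i) + ∑ i, ∑ j, α i * α j * inner ℝ (a j) (u j)
        - ∑ i, ∑ j, α i * α j * inner ℝ (a i) (u j)
        - ∑ i, ∑ j, α i * α j * inner ℝ (a j) (u i) := by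
    simp only [← Finset.sum_add_distrib, ← Finset.sum_sub_distrib]
    refine Finset.sum_congr rfl fun i _ => Finset.sum_congr rfl fun j _ => ?_
    simp only [inner_sub_left, inner_sub_right]
    ring
  rw [e5, e1, e2, e3, e4] at h0
  linarith

/-- Finite form of the Debrunner–Flor extension property in a Hilbert space. -/
theorem exists_forall_inner_sub_nonpos {ι : Type*} [Fintype ι] [Nonempty ι] (a u : ι → H)
    (h : ∀ i j, inner ℝ (a i - a j) (u i - u j) ≤ 0) :
    ∃ x : H, ∀ i, inner ℝ (x - a i) (x - u i) ≤ 0 := by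
  classical
  -- Averaging ⟪x - a_i, x - u_i⟫ with weights α gives ‖x‖² - ⟪x, w α⟫ + c α, minimal at x = w α / 2
  -- with value c α - ‖w α‖² / 4. Maximizing this value over the simplex gives a saddle point.
  let w : (ι → ℝ) → H := fun α => ∑ i, α i • (a i + u i)
  let c : (ι → ℝ) → ℝ := fun α => ∑ i, α i * inner ℝ (a i) (u i)
  have hcont : Continuous fun α => c α - ‖w α‖ ^ 2 / 4 := by fun_prop
  obtain ⟨i0⟩ := ‹Nonempty ι›
  obtain ⟨α, hα, hmax⟩ := (isCompact_stdSimplex ℝ ι).exists_isMaxOn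
    ⟨_, single_mem_stdSimplex ℝ i0⟩ hcont.continuousOn
  have hcw : c α ≤ ‖w α‖ ^ 2 / 4 := by
    have h1 := sum_inner_le_inner_sum a u h α hα.1 hα.2
    have h2 : w α = (∑ i, α i • a i) + ∑ i, α i • u i := by
      simp only [w, smul_add, Finset.sum_add_distrib]
    have h3 := norm_add_sq_real (∑ i, α i • a i) (∑ i, α i • u i)
    have h4 := norm_sub_sq_real (∑ i, α i • a i) (∑ i, α i • u i)
    have h5 := sq_nonneg ‖(∑ i, α i • a i) - ∑ i, α i • u i‖
    rw [h2]
    linarith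
  refine ⟨(1 / 2 : ℝ) • w α, fun i => ?_⟩
  -- First-order optimality: compare α with its displacement by t towards the vertex i, then let t
  -- tend to 0.
  have hdir : ∀ t : ℝ, 0 < t → t ≤ 1 →
      inner ℝ (a i) (u i) - c α - inner ℝ (w α) (a i + u i - w α) / 2
        ≤ t * (‖a i + u i - w α‖ ^ 2 / 4) := by
    intro t ht ht1
    have hmem : α + t • (Pi.single i 1 - α) ∈ stdSimplex ℝ ι :=
      (convex_stdSimplex ℝ ι).add_smul_sub_mem hα (single_mem_stdSimplex ℝ i) ⟨ht.le, ht1⟩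
    have hm := hmax hmem
    have hw : w (α + t • (Pi.single i 1 - α)) = w α + t • (a i + u i - w α) := by
      simp only [w, Pi.add_apply, Pi.smul_apply, Pi.sub_apply, smul_eq_mul, add_smul,
        Finset.sum_add_distrib, mul_smul, sub_smul, ← Finset.smul_sum, Finset.sum_sub_distrib]
      congr 2
      simp [Pi.single_apply, Finset.sum_add_distrib]
    have hc : c (α + t • (Pi.single i 1 - α)) = c α + t * (inner ℝ (a i) (u i) - c α) := by
      simp only [c, Pi.add_apply, Pi.smul_apply, Pi.sub_apply, smul_eq_mul, add_mul,
        Finset.sum_add_distrib, mul_assoc, sub_mul, ← Finset.mul_sum, Finset.sum_sub_distrib]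
      simp [Pi.single_apply]
    simp only [Set.mem_ofPred_eq, hw, hc] at hm
    rw [norm_add_sq_real, real_inner_smul_right, norm_smul, Real.norm_eq_abs, mul_pow,
      sq_abs] at hm
    have : t * (inner ℝ (a i) (u i) - c α - inner ℝ (w α) (a i + u i - w α) / 2)
        ≤ t * (t * (‖a i + u i - w α‖ ^ 2 / 4)) := by nlinarith
    exact le_of_mul_le_mul_left this ht
  have hlim : inner ℝ (a i) (u i) - c α - inner ℝ (w α) (a i + u i - w α) / 2 ≤ 0 := by
    have ht : Tendsto (fun t : ℝ => t * (‖a i + u i - w α‖ ^ 2 / 4)) (𝓝[>] 0)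
        (𝓝 (0 * (‖a i + u i - w α‖ ^ 2 / 4))) :=
      (tendsto_id.mul_const _).mono_left nhdsWithin_le_nhds
    rw [zero_mul] at ht
    refine ge_of_tendsto ht ?_
    filter_upwards [Ioc_mem_nhdsGT (zero_lt_one' ℝ)] with t ht
    exact hdir t ht.1 ht.2
  have hs := real_inner_self_eq_norm_sq (w α)
  simp only [inner_sub_left, inner_sub_right, inner_add_right, real_inner_smul_left,
    real_inner_smul_right] at hlim ⊢
  rw [hs] at hlim ⊢
  have := real_inner_comm (w α) (a i)
  linarith

end Hilbert

/-! ### Maximal monotone operators, Minty's theorem and the proximal inequality -/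

section MaximalMonotone

variable {H : Type*} [NormedAddCommGroup H] [InnerProductSpace ℝ H] {T : H → Set H}

/-- Adjoining (x, y) to the graph keeps it monotone, so maximality says the point was already there.
-/
theorem IsMaximalMonotoneOp.mem_of_forall (hT : IsMaximalMonotoneOp T) {x y : H}
    (h : ∀ u, ∀ v ∈ T u, 0 ≤ inner ℝ (y - v) (x - u)) : y ∈ T x := by
  have hmono : IsMonotoneOp fun z => {w | w ∈ T z ∨ (z = x ∧ w = y)} := by
    rintro a b a' b' (hb | ⟨rfl, rfl⟩) (hb' | ⟨rfl, rfl⟩)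
    · exact hT.1 a b a' b' hb hb'
    · have := h a b hb
      rwa [← neg_sub b, ← neg_sub a, inner_neg_neg] at this
    · exact h a' b' hb'
    · simp
  rw [hT.2 _ hmono fun z w hw => Or.inl hw]
  exact Or.inr ⟨rfl, rfl⟩

/-- Minty's theorem: the resolvent of a maximal monotone operator is everywhere defined. -/
theorem IsMaximalMonotoneOp.resolventSet_nonempty [CompleteSpace H]
    (hT : IsMaximalMonotoneOp T) {t : ℝ} (ht : 0 < t) (z : H) :
    (resolventSet T t z).Nonempty := by
  classical
  suffices h : ∃ x : H, ∀ p : {p : H × H // p.2 ∈ T p.1},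
      inner ℝ (x - (z - t • p.1.2)) (x - p.1.1) ≤ 0 by
    obtain ⟨x, hx⟩ := h
    refine ⟨x, hT.mem_of_forall fun u v hv => ?_⟩
    have h1 := hx ⟨(u, v), hv⟩
    have h2 : t⁻¹ • (z - x) - v = (-t⁻¹) • (x - (z - t • v)) := by
      simp only [smul_sub, neg_smul, smul_smul]
      rw [neg_mul, inv_mul_cancel₀ ht.ne']
      module
    rw [h2, real_inner_smul_left]
    exact mul_nonneg_of_nonpos_of_nonpos (by simpa using ht.le) h1
  rcases isEmpty_or_nonempty {p : H × H // p.2 ∈ T p.1} with hE | ⟨⟨p0⟩⟩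
  · exact ⟨z, fun p => hE.elim p⟩
  -- The fixed point `p0` is inserted into every finite set so that its inequality bounds all the
  -- solutions `x F` uniformly.
  have hfin : ∀ F : Finset {p : H × H // p.2 ∈ T p.1}, ∃ x : H, ∀ p ∈ insert p0 F,
      inner ℝ (x - (z - t • p.1.2)) (x - p.1.1) ≤ 0 := by
    intro F
    have : Nonempty ↥(insert p0 F) := ⟨⟨p0, Finset.mem_insert_self _ _⟩⟩
    obtain ⟨x, hx⟩ := exists_forall_inner_sub_nonpos
      (fun p : ↥(insert p0 F) => z - t • p.1.1.2) (fun p => p.1.1.1) (by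
        intro i j
        have h1 := hT.1 _ _ _ _ i.1.2 j.1.2
        have h2 : z - t • i.1.1.2 - (z - t • j.1.1.2) = (-t) • (i.1.1.2 - j.1.1.2) := by module
        rw [h2, real_inner_smul_left]
        nlinarith)
    exact ⟨x, fun p hp => hx ⟨p, hp⟩⟩
  choose x hx using hfin
  have hexp : ∀ F, ∀ p ∈ insert p0 F,
      ‖x F‖ ^ 2 ≤ inner ℝ (x F) (z - t • p.1.2 + p.1.1) - inner ℝ (z - t • p.1.2) p.1.1 := by
    intro F p hp
    have h1 := hx F p hp
    rw [inner_sub_left, inner_sub_right, inner_sub_right, real_inner_self_eq_norm_sq,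
      real_inner_comm (x F) (z - t • p.1.2)] at h1
    rw [inner_add_right]
    linarith
  set w0 := z - t • p0.1.2 + p0.1.1
  set c0 := inner ℝ (z - t • p0.1.2) p0.1.1
  have hbd : ∀ F, ‖x F‖ ≤ ‖w0‖ + |c0| + 1 := by
    intro F
    have h1 := hexp F p0 (Finset.mem_insert_self _ _)
    have h2 := real_inner_le_norm (x F) w0
    have h3 := neg_abs_le c0
    by_contra! h4
    have h5 := norm_nonneg w0
    have h6 := abs_nonneg c0
    nlinarith
  let U : Ultrafilter (Finset {p : H × H // p.2 ∈ T p.1}) := Ultrafilter.of atTop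
  have hU : (U : Filter (Finset {p : H × H // p.2 ∈ T p.1})) ≤ atTop := Ultrafilter.of_le _
  obtain ⟨y, hy⟩ := exists_weakLimit_of_bounded U x _ (Eventually.of_forall hbd)
  refine ⟨y, fun p => ?_⟩
  -- Weak lower semicontinuity of the square norm, in the form 2⟪x F, y⟫ - ‖y‖² ≤ ‖x F‖².
  have h1 : ∀ᶠ F in (U : Filter _), 2 * inner ℝ (x F) y - ‖y‖ ^ 2
      ≤ inner ℝ (x F) (z - t • p.1.2 + p.1.1) - inner ℝ (z - t • p.1.2) p.1.1 := by
    filter_upwards [hU (Ici_mem_atTop {p})] with F hF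
    have h2 := hexp F p (Finset.mem_insert_of_mem (hF (Finset.mem_singleton_self p)))
    have h3 := norm_sub_sq_real (x F) y
    have h4 := sq_nonneg ‖x F - y‖
    linarith
  have h2 := le_of_tendsto_of_tendsto (((hy y).const_mul 2).sub_const _)
    ((hy (z - t • p.1.2 + p.1.1)).sub_const _) h1
  rw [inner_sub_left, inner_sub_right, inner_sub_right, real_inner_self_eq_norm_sq,
    real_inner_comm y (z - t • p.1.2)]
  rw [inner_add_right, real_inner_self_eq_norm_sq] at h2
  linarith

theorem IsMaximalMonotoneOp.resolvent_mem [CompleteSpace H]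
    (hT : IsMaximalMonotoneOp T) {t : ℝ} (ht : 0 < t) (x : H) :
    t⁻¹ • (x - resolvent T t x) ∈ T (resolvent T t x) :=
  Classical.epsilon_spec (hT.resolventSet_nonempty ht x)

/-- Monotonicity between (y, v) and the resolvent point, cleared of `t⁻¹` so that `t` may later tend
to 0. -/
theorem IsMaximalMonotoneOp.inner_resolvent_le [CompleteSpace H]
    (hT : IsMaximalMonotoneOp T) {t : ℝ} (ht : 0 < t) (x : H) {y v : H} (hv : v ∈ T y) :
    t * inner ℝ v (resolvent T t x - y)
      ≤ inner ℝ (x - resolvent T t x) (resolvent T t x - y) := by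
  have h := hT.1 _ _ _ _ (hT.resolvent_mem ht x) hv
  rw [inner_sub_left, real_inner_smul_left] at h
  have h2 : t * inner ℝ v (resolvent T t x - y)
      ≤ t * (t⁻¹ * inner ℝ (x - resolvent T t x) (resolvent T t x - y)) :=
    mul_le_mul_of_nonneg_left (by linarith) ht.le
  rwa [mul_inv_cancel_left₀ ht.ne'] at h2

theorem IsMaximalMonotoneOp.norm_resolvent_sub_le [CompleteSpace H]
    (hT : IsMaximalMonotoneOp T) {t : ℝ} (ht : 0 < t) (x y : H) :
    ‖resolvent T t x - resolvent T t y‖ ≤ ‖x - y‖ := by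
  have h := hT.inner_resolvent_le ht x (hT.resolvent_mem ht y)
  rw [real_inner_smul_left, mul_inv_cancel_left₀ ht.ne'] at h
  set a := resolvent T t x
  set b := resolvent T t y
  have h2 : ‖a - b‖ ^ 2 ≤ inner ℝ (x - y) (a - b) := by
    rw [← real_inner_self_eq_norm_sq]
    simp only [inner_sub_left, inner_sub_right] at h ⊢
    linarith
  have h3 := real_inner_le_norm (x - y) (a - b)
  rcases (norm_nonneg (a - b)).eq_or_lt with h0 | h0
  · rw [← h0]; positivity
  · exact le_of_mul_le_mul_right (by nlinarith) h0

/-- Expand ‖x - y‖² around the resolvent a; the leftover 2t⟪v, x - a⟫ - ‖x - a‖² is at most t²‖v‖².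
Having x rather than a in the inner product makes that term a martingale increment when v has mean
zero. -/
theorem IsMaximalMonotoneOp.norm_resolvent_sub_sq_le [CompleteSpace H]
    (hT : IsMaximalMonotoneOp T) {t : ℝ} (ht : 0 < t) (x : H) {y v : H} (hv : v ∈ T y) :
    ‖resolvent T t x - y‖ ^ 2
      ≤ ‖x - y‖ ^ 2 - 2 * t * inner ℝ v (x - y) + t ^ 2 * ‖v‖ ^ 2 := by
  have h := hT.inner_resolvent_le ht x hv
  set a := resolvent T t x
  have h1 : ‖x - y‖ ^ 2 = ‖x - a‖ ^ 2 + 2 * inner ℝ (x - a) (a - y) + ‖a - y‖ ^ 2 := by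
    rw [← norm_add_sq_real]; congr 2; abel
  have h2 : inner ℝ v (x - y) = inner ℝ v (x - a) + inner ℝ v (a - y) := by
    rw [← inner_add_right]; congr 1; abel
  have h3 := norm_sub_sq_real (x - a) (t • v)
  rw [real_inner_smul_right, norm_smul, mul_pow, Real.norm_eq_abs, sq_abs,
    real_inner_comm v (x - a)] at h3
  have h4 := sq_nonneg ‖x - a - t • v‖
  rw [h1, h2]
  linarith

theorem IsMaximalMonotoneOp.resolvent_mem_opDom [CompleteSpace H]
    (hT : IsMaximalMonotoneOp T) {t : ℝ} (ht : 0 < t) (x : H) :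
    resolvent T t x ∈ opDom T := ⟨_, hT.resolvent_mem ht x⟩

end MaximalMonotone

/-! ### Independence, martingale convergence and a summability recursion -/

section Probability

variable {Ω : Type*} [mΩ : MeasurableSpace Ω] {P : Measure Ω} [IsProbabilityMeasure P]
variable {E : Type*} [MeasurableSpace E] {μ : Measure E} [IsProbabilityMeasure μ]
variable {α : Type*} [MeasurableSpace α]

/-- A function of two independent variables is integrable as soon as its partial integrals of
the absolute value are dominated by an integrable function. -/
theorem integrable_comp_of_indepFun {X : Ω → α} {η : Ω → E} (hX : Measurable X)
    (hη : Measurable η) (hlaw : P.map η = μ) (hind : IndepFun X η P) {F : α → E → ℝ}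
    (hF : Measurable (Function.uncurry F)) (hFint : ∀ a, Integrable (F a) μ)
    {g : Ω → ℝ} (hg : Integrable g P) (hFg : ∀ ω, ∫ s, |F (X ω) s| ∂μ ≤ g ω) :
    Integrable (fun ω => F (X ω) (η ω)) P := by
  have hmap := (indepFun_iff_map_prod_eq_prod_map_map hX.aemeasurable hη.aemeasurable).1 hind
  rw [hlaw] at hmap
  refine ⟨(hF.comp (hX.prodMk hη)).aestronglyMeasurable, ?_⟩
  have hm : Measurable fun p : α × E => ‖Function.uncurry F p‖ₑ := hF.enorm
  calc ∫⁻ ω, ‖F (X ω) (η ω)‖ₑ ∂P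
      = ∫⁻ p, ‖Function.uncurry F p‖ₑ ∂(P.map fun ω => (X ω, η ω)) := by
        rw [lintegral_map hm (hX.prodMk hη)]; rfl
    _ = ∫⁻ a, ∫⁻ s, ‖F a s‖ₑ ∂μ ∂(P.map X) := by
        rw [hmap, lintegral_prod _ hm.aemeasurable]; rfl
    _ = ∫⁻ ω, ∫⁻ s, ‖F (X ω) s‖ₑ ∂μ ∂P := lintegral_map hm.lintegral_prod_right' hX
    _ ≤ ∫⁻ ω, ‖g ω‖ₑ ∂P := by
        refine lintegral_mono fun ω => ?_
        have h1 := ofReal_integral_norm_eq_lintegral_enorm (hFint (X ω))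
        rw [← h1, ← ofReal_norm]
        exact ENNReal.ofReal_le_ofReal ((hFg ω).trans (le_abs_self _))
    _ < ∞ := hg.2

/-- Fubini for the joint law of (X, η); it plays the role of conditioning on X. -/
theorem integral_comp_of_indepFun {X : Ω → α} {η : Ω → E} (hX : Measurable X)
    (hη : Measurable η) (hlaw : P.map η = μ) (hind : IndepFun X η P) {F : α → E → ℝ}
    (hF : Measurable (Function.uncurry F))
    (hint : Integrable (fun ω => F (X ω) (η ω)) P) :
    ∫ ω, F (X ω) (η ω) ∂P = ∫ ω, ∫ s, F (X ω) s ∂μ ∂P := by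
  have hmap := (indepFun_iff_map_prod_eq_prod_map_map hX.aemeasurable hη.aemeasurable).1 hind
  rw [hlaw] at hmap
  have h1 : Integrable (Function.uncurry F) ((P.map X).prod μ) := by
    rw [← hmap, integrable_map_measure hF.aestronglyMeasurable (hX.prodMk hη).aemeasurable]
    exact hint
  calc ∫ ω, F (X ω) (η ω) ∂P
      = ∫ p, Function.uncurry F p ∂(P.map fun ω => (X ω, η ω)) := by
        rw [integral_map (hX.prodMk hη).aemeasurable hF.aestronglyMeasurable]; rfl
    _ = ∫ a, ∫ s, F a s ∂μ ∂(P.map X) := by rw [hmap, integral_prod _ h1]; rfl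
    _ = ∫ ω, ∫ s, F (X ω) s ∂μ ∂P := by
        rw [integral_map hX.aemeasurable]
        exact hF.stronglyMeasurable.integral_prod_right'.aestronglyMeasurable

theorem sq_integral_le_integral_sq {f : E → ℝ} (hf : MemLp f 2 μ) :
    ∫ s, (f s - ∫ u, f u ∂μ) ^ 2 ∂μ ≤ ∫ s, f s ^ 2 ∂μ := by
  have h1 := hf.integrable one_le_two
  have h2 := hf.integrable_sq
  set m := ∫ u, f u ∂μ
  have h3 : ∫ s, (f s - m) ^ 2 ∂μ = ∫ s, (f s ^ 2 - 2 * m * f s + m ^ 2) ∂μ :=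
    integral_congr_ae (Eventually.of_forall fun s => by simp only; ring)
  have h4 : Integrable (fun s => f s ^ 2 - 2 * m * f s) μ := h2.sub (h1.const_mul _)
  rw [h3, integral_add h4 (integrable_const _), integral_sub h2 (h1.const_mul _),
    integral_const_mul]
  simp only [integral_const, probReal_univ, smul_eq_mul, one_mul]
  nlinarith [sq_nonneg m]

variable {ℱ : Filtration ℕ mΩ} {η : ℕ → Ω → E} {X : ℕ → Ω → α}

/-- Almost sure convergence of `L²`-bounded sums of centered functions of an adapted process
and an independent innovation. -/
theorem ae_tendsto_sum_of_centered (hη : ∀ n, Measurable[ℱ (n + 1)] (η n))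
    (hlaw : ∀ n, P.map (η n) = μ)
    (hind : ∀ n, Indep (ℱ n) (MeasurableSpace.comap (η n) inferInstance) P)
    (hX : ∀ n, Measurable[ℱ n] (X n)) {D : ℕ → α → E → ℝ}
    (hD : ∀ n, Measurable (Function.uncurry (D n))) (hD2 : ∀ n a, MemLp (D n a) 2 μ)
    (hD0 : ∀ n a, ∫ s, D n a s ∂μ = 0) {g : ℕ → Ω → ℝ} (hg : ∀ n, Integrable (g n) P)
    (hDg : ∀ n ω, ∫ s, D n (X n ω) s ^ 2 ∂μ ≤ g n ω) (hsum : Summable fun n => ∫ ω, g n ω ∂P) :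
    ∀ᵐ ω ∂P, ∃ L, Tendsto (fun n => ∑ k ∈ Finset.range n, D k (X k ω) (η k ω)) atTop (𝓝 L) := by
  have hη' : ∀ n, Measurable (η n) := fun n => (hη n).mono (ℱ.le _) le_rfl
  have hX' : ∀ n, Measurable (X n) := fun n => (hX n).mono (ℱ.le _) le_rfl
  have hXη : ∀ n, IndepFun (X n) (η n) P := fun n => by
    rw [IndepFun_iff_Indep]
    exact indep_of_indep_of_le_left (hind n) (hX n).comap_le
  set Z : ℕ → Ω → ℝ := fun n ω => D n (X n ω) (η n ω)
  have hZm : ∀ n, Measurable (Z n) := fun n => (hD n).comp ((hX' n).prodMk (hη' n))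
  have hZsq : ∀ n, Integrable (fun ω => Z n ω ^ 2) P := fun n =>
    integrable_comp_of_indepFun (hX' n) (hη' n) (hlaw n) (hXη n) (F := fun a s => D n a s ^ 2)
      ((hD n).pow_const 2) (fun a => (hD2 n a).integrable_sq) (hg n)
      (fun ω => by simpa only [abs_sq] using hDg n ω)
  have hZ2 : ∀ n, MemLp (Z n) 2 P := fun n =>
    (memLp_two_iff_integrable_sq (hZm n).aestronglyMeasurable).2 (hZsq n)
  have hZle : ∀ n, ∫ ω, Z n ω ^ 2 ∂P ≤ ∫ ω, g n ω ∂P := fun n => by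
    have h1 := integral_comp_of_indepFun (hX' n) (hη' n) (hlaw n) (hXη n)
      (F := fun a s => D n a s ^ 2) ((hD n).pow_const 2) (hZsq n)
    have h2 : Measurable fun ω => ∫ s, D n (X n ω) s ^ 2 ∂μ :=
      (((hD n).pow_const 2).stronglyMeasurable.integral_prod_right'.measurable).comp (hX' n)
    calc ∫ ω, Z n ω ^ 2 ∂P = ∫ ω, ∫ s, D n (X n ω) s ^ 2 ∂μ ∂P := h1
      _ ≤ ∫ ω, g n ω ∂P := by
        refine integral_mono_of_nonneg (Eventually.of_forall fun ω => ?_) (hg n)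
          (Eventually.of_forall (hDg n))
        exact integral_nonneg fun s => sq_nonneg _
  -- Used twice: indicators Y give the martingale property, and Y = M n gives additivity of the
  -- second moments.
  have horth : ∀ n (Y : Ω → ℝ), Measurable[ℱ n] Y → MemLp Y 2 P →
      ∫ ω, Y ω * Z n ω ∂P = 0 := by
    intro n Y hY hY2
    have hXY : Measurable[ℱ n] fun ω => (X n ω, Y ω) := (hX n).prodMk hY
    have hi : IndepFun (fun ω => (X n ω, Y ω)) (η n) P := by
      rw [IndepFun_iff_Indep]
      exact indep_of_indep_of_le_left (hind n) hXY.comap_le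
    have hFm : Measurable (Function.uncurry fun (a : α × ℝ) s => a.2 * D n a.1 s) := by
      have := (hD n).comp ((measurable_fst.comp measurable_fst).prodMk measurable_snd :
        Measurable fun p : (α × ℝ) × E => (p.1.1, p.2))
      exact (measurable_snd.comp measurable_fst).mul this
    rw [integral_comp_of_indepFun (hXY.mono (ℱ.le _) le_rfl) (hη' n) (hlaw n) hi
      (F := fun a s => a.2 * D n a.1 s) hFm (hY2.integrable_mul (hZ2 n))]
    simp [integral_const_mul, hD0]
  set M : ℕ → Ω → ℝ := fun n ω => ∑ k ∈ Finset.range n, Z k ω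
  have hMm : ∀ n, Measurable[ℱ n] (M n) := by
    intro n
    refine Finset.measurable_sum _ fun k hk => ?_
    have hk' : k + 1 ≤ n := Finset.mem_range.1 hk
    exact (hD k).comp (((hX k).mono (ℱ.mono (by omega)) le_rfl).prodMk
      ((hη k).mono (ℱ.mono hk') le_rfl))
  have hM2 : ∀ n, MemLp (M n) 2 P := fun n => memLp_finsetSum _ fun k _ => hZ2 k
  have hMsucc : ∀ n ω, M (n + 1) ω = M n ω + Z n ω := fun n ω => Finset.sum_range_succ _ _
  have hmart : Martingale M ℱ P := by
    refine martingale_of_setIntegral_eq_succ (fun n => (hMm n).stronglyMeasurable)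
      (fun n => (hM2 n).integrable one_le_two) fun n B hB => ?_
    have h1 := horth n (B.indicator 1) (measurable_const.indicator hB)
      ((memLp_const (1 : ℝ)).indicator (ℱ.le _ _ hB))
    have h2 : (fun ω => B.indicator (1 : Ω → ℝ) ω * Z n ω) = B.indicator (Z n) := by
      ext ω; by_cases h : ω ∈ B <;> simp [h]
    rw [h2, integral_indicator (ℱ.le _ _ hB)] at h1
    simp only [hMsucc]
    rw [integral_add ((hM2 n).integrable one_le_two).integrableOn
      ((hZ2 n).integrable one_le_two).integrableOn, h1, add_zero]
  have hMsq : ∀ n, ∫ ω, M n ω ^ 2 ∂P ≤ ∑ k ∈ Finset.range n, ∫ ω, g k ω ∂P := by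
    intro n
    induction n with
    | zero => simp [M]
    | succ n ih =>
      have h1 : ∫ ω, M (n + 1) ω ^ 2 ∂P
          = ∫ ω, M n ω ^ 2 ∂P + 2 * ∫ ω, M n ω * Z n ω ∂P + ∫ ω, Z n ω ^ 2 ∂P := by
        have h2 : Integrable (fun ω => 2 * (M n ω * Z n ω)) P :=
          ((hM2 n).integrable_mul (hZ2 n)).const_mul 2
        have h3 : Integrable (fun ω => M n ω ^ 2 + 2 * (M n ω * Z n ω)) P :=
          (hM2 n).integrable_sq.add h2
        rw [← integral_const_mul, ← integral_add (hM2 n).integrable_sq h2,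
          ← integral_add h3 (hZsq n)]
        refine integral_congr_ae (Eventually.of_forall fun ω => ?_)
        simp only [hMsucc]
        ring
      rw [h1, horth n _ (hMm n) (hM2 n), Finset.sum_range_succ]
      linarith [hZle n]
  have hb0 : ∀ n, 0 ≤ ∫ ω, g n ω ∂P := fun n =>
    (integral_nonneg fun ω => sq_nonneg (Z n ω)).trans (hZle n)
  refine hmart.submartingale.exists_ae_tendsto_of_bdd
    (R := Real.toNNReal (1 + ∑' n, ∫ ω, g n ω ∂P)) fun n => ?_
  rw [eLpNorm_one_eq_lintegral_enorm,
    ← ofReal_integral_norm_eq_lintegral_enorm ((hM2 n).integrable one_le_two)]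
  refine ENNReal.ofReal_le_ofReal ?_
  calc ∫ ω, ‖M n ω‖ ∂P ≤ ∫ ω, (1 + M n ω ^ 2) ∂P := by
        refine integral_mono ((hM2 n).integrable one_le_two).norm
          ((integrable_const _).add (hM2 n).integrable_sq) fun ω => ?_
        simp only [Real.norm_eq_abs]
        rw [← sq_abs (M n ω)]
        nlinarith [sq_nonneg (|M n ω| - 1), abs_nonneg (M n ω)]
    _ = 1 + ∫ ω, M n ω ^ 2 ∂P := by
        rw [integral_add (integrable_const _) (hM2 n).integrable_sq]; simp
    _ ≤ 1 + ∑' n, ∫ ω, g n ω ∂P := by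
        gcongr
        exact (hMsq n).trans (hsum.sum_le_tsum _ fun k _ => hb0 k)

/-- Sums of functions of an adapted process and an independent innovation, centered at their
conditional expectations, converge almost surely when the second moments are summable. -/
theorem ae_tendsto_sum_sub_integral (hη : ∀ n, Measurable[ℱ (n + 1)] (η n))
    (hlaw : ∀ n, P.map (η n) = μ)
    (hind : ∀ n, Indep (ℱ n) (MeasurableSpace.comap (η n) inferInstance) P)
    (hX : ∀ n, Measurable[ℱ n] (X n)) {F : ℕ → α → E → ℝ}
    (hF : ∀ n, Measurable (Function.uncurry (F n))) (hF2 : ∀ n a, MemLp (F n a) 2 μ)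
    {g : ℕ → Ω → ℝ} (hg : ∀ n, Integrable (g n) P)
    (hFg : ∀ n ω, ∫ s, F n (X n ω) s ^ 2 ∂μ ≤ g n ω) (hsum : Summable fun n => ∫ ω, g n ω ∂P) :
    ∀ᵐ ω ∂P, ∃ L, Tendsto
      (fun n => ∑ k ∈ Finset.range n, (F k (X k ω) (η k ω) - ∫ s, F k (X k ω) s ∂μ))
      atTop (𝓝 L) := by
  refine ae_tendsto_sum_of_centered hη hlaw hind hX
    (D := fun n a s => F n a s - ∫ u, F n a u ∂μ) (fun n => ?_)
    (fun n a => (hF2 n a).sub (memLp_const _)) (fun n a => ?_) hg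
    (fun n ω => (sq_integral_le_integral_sq (hF2 n (X n ω))).trans (hFg n ω)) hsum
  · exact (hF n).sub
      ((hF n).stronglyMeasurable.integral_prod_right'.measurable.comp measurable_fst)
  · rw [integral_sub ((hF2 n a).integrable one_le_two) (integrable_const _)]
    simp

/-- The partial sums satisfy S_n ≤ S_{n+1} ≤ a 0 + r S_n + ∑ b, hence (1 - r) S_n ≤ a 0 + ∑ b. -/
theorem summable_of_le_mul_add {a b : ℕ → ℝ} {r : ℝ} (ha : ∀ n, 0 ≤ a n) (hr : r < 1) (hb0 : ∀ n, 0 ≤ b n) (hb : Summable b)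
    (h : ∀ n, a (n + 1) ≤ r * a n + b n) : Summable a := by
  refine summable_of_sum_range_le (c := (a 0 + ∑' n, b n) / (1 - r)) ha fun n => ?_
  rw [le_div_iff₀ (by linarith)]
  have h1 : ∑ k ∈ Finset.range n, a (k + 1)
      ≤ r * ∑ k ∈ Finset.range n, a k + ∑ k ∈ Finset.range n, b k := by
    rw [Finset.mul_sum, ← Finset.sum_add_distrib]
    exact Finset.sum_le_sum fun k _ => h k
  have h2 := Finset.sum_range_succ a n
  have h3 := Finset.sum_range_succ' a n
  have h4 := hb.sum_le_tsum (Finset.range n) fun k _ => hb0 k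
  have h5 := ha n
  linarith

end Probability

/-! ### Random resolvents: measurability, displacement and contraction towards the essential domain
-/

section RandomResolvent

variable {E : Type*} {H : Type*} [NormedAddCommGroup H] [InnerProductSpace ℝ H]
variable {A : E → H → Set H}

open Classical in
/-- The resolvent of `A s`, replaced by the identity where `A s` is not maximal monotone. -/
noncomputable def safeResolvent (A : E → H → Set H) (t : ℝ) (x : H) (s : E) : H :=
  if IsMaximalMonotoneOp (A s) then resolvent (A s) t x else x

theorem safeResolvent_eq {s : E} (hs : IsMaximalMonotoneOp (A s)) (t : ℝ) (x : H) :
    safeResolvent A t x s = resolvent (A s) t x := if_pos hs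

theorem norm_safeResolvent_sub_le [CompleteSpace H] {t : ℝ} (ht : 0 < t) (x y : H) (s : E) :
    ‖safeResolvent A t x s - safeResolvent A t y s‖ ≤ ‖x - y‖ := by
  unfold safeResolvent
  split_ifs with h
  · exact h.norm_resolvent_sub_le ht x y
  · exact le_rfl

theorem continuous_safeResolvent [CompleteSpace H] {t : ℝ} (ht : 0 < t) (s : E) :
    Continuous fun x => safeResolvent A t x s :=
  (LipschitzWith.of_dist_le_mul (K := 1) fun x y => by
    simpa [dist_eq_norm] using norm_safeResolvent_sub_le ht x y s).continuous

variable [MeasurableSpace E] {μ : Measure E} [MeasurableSpace H]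

/-- The set where `A s` fails to be maximal monotone is null, hence measurable by completeness of
`μ`. -/
theorem measurable_safeResolvent [μ.IsComplete]
    (hA_max : ∀ᵐ s ∂μ, IsMaximalMonotoneOp (A s)) {t : ℝ} {x : H}
    (hm : Measurable fun s => resolvent (A s) t x) :
    Measurable fun s => safeResolvent A t x s := by
  classical
  have hG : MeasurableSet {s | IsMaximalMonotoneOp (A s)} :=
    MeasurableSet.of_compl (Measure.IsComplete.out' _ hA_max)
  exact Measurable.ite hG hm measurable_const

variable [BorelSpace H] [CompleteSpace H] [TopologicalSpace.SeparableSpace H]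

/-- A Carathéodory argument. It needs continuity in x for every s, which is why the resolvent is
replaced by the identity at the bad s. -/
theorem measurable_uncurry_safeResolvent [μ.IsComplete]
    (hA_max : ∀ᵐ s ∂μ, IsMaximalMonotoneOp (A s)) {t : ℝ} (ht : 0 < t)
    (hm : ∀ x, Measurable fun s => resolvent (A s) t x) :
    Measurable (Function.uncurry (safeResolvent A t)) := by
  have : SecondCountableTopology H := UniformSpace.secondCountable_of_separable H
  exact measurable_uncurry_of_continuous_of_measurable (fun s => continuous_safeResolvent ht s)
    fun x => measurable_safeResolvent hA_max (hm x)

/-- The strong limit of the resolvents as the parameter tends to zero satisfies the variational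
inequality characterizing the projection onto the closure of the domain. -/
theorem exists_limit_resolvent
    (hA_max : ∀ᵐ s ∂μ, IsMaximalMonotoneOp (A s))
    (hA_meas : ∀ t : ℝ, 0 < t → ∀ x : H, Measurable fun s => resolvent (A s) t x)
    {p : ℕ} {C : E → ℝ}
    (hres : ∀ (x : H) (t : ℝ), 0 < t → ∀ᵐ s ∂μ,
      ‖resolvent (A s) t x - proj (closure (opDom (A s))) x‖ ≤ t * C s * (1 + ‖x‖ ^ p)) (x : H) :
    ∃ Q : E → H, AEStronglyMeasurable Q μ ∧
      (∀ t : ℝ, 0 < t → ∀ᵐ s ∂μ, ‖safeResolvent A t x s - Q s‖ ≤ t * C s * (1 + ‖x‖ ^ p)) ∧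
      (∀ y ∈ essDom μ A, ∀ᵐ s ∂μ, ‖Q s - y‖ ^ 2 ≤ ‖x - y‖ ^ 2 - ‖x - Q s‖ ^ 2) ∧
      ∀ᵐ s ∂μ, Metric.infEDist x (opDom (A s)) ≤ ‖x - Q s‖ₑ := by
  have : SecondCountableTopology H := UniformSpace.secondCountable_of_separable H
  set Q : E → H := fun s => proj (closure (opDom (A s))) x
  let t : ℕ → ℝ := fun m => 1 / ((m : ℝ) + 1)
  have ht : ∀ m, 0 < t m := fun m => Nat.one_div_pos_of_nat
  have ht0 : Tendsto t atTop (𝓝 0) := tendsto_one_div_add_atTop_nhds_zero_nat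
  -- Every property of `Q` claimed below, except the rate estimate, is inherited from the resolvents
  -- through this limit; the nearest-point property of `proj` is never needed.
  have hlim : ∀ᵐ s ∂μ, Tendsto (fun m => resolvent (A s) (t m) x) atTop (𝓝 (Q s)) := by
    filter_upwards [ae_all_iff.2 fun m => hres x (t m) (ht m)] with s hs
    rw [tendsto_iff_norm_sub_tendsto_zero]
    refine squeeze_zero (fun _ => norm_nonneg _) hs ?_
    simpa using (ht0.mul_const (C s)).mul_const (1 + ‖x‖ ^ p)
  refine ⟨Q, ?_, fun t ht => ?_, fun y hy => ?_, ?_⟩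
  · exact (aemeasurable_of_tendsto_metrizable_ae atTop
      (fun m => (hA_meas (t m) (ht m) x).aemeasurable) hlim).aestronglyMeasurable
  · filter_upwards [hA_max, hres x t ht] with s hs hs'
    rwa [safeResolvent_eq hs]
  · filter_upwards [hA_max, hlim, hy] with s hs hls hys
    obtain ⟨v, hv⟩ := hys
    have h1 : 0 * inner ℝ v (Q s - y) ≤ inner ℝ (x - Q s) (Q s - y) :=
      le_of_tendsto_of_tendsto' (ht0.mul (tendsto_const_nhds.inner (hls.sub_const y)))
        ((hls.const_sub x).inner (hls.sub_const y))
        fun m => hs.inner_resolvent_le (ht m) x hv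
    have h2 : ‖x - y‖ ^ 2 = ‖x - Q s‖ ^ 2 + 2 * inner ℝ (x - Q s) (Q s - y) + ‖Q s - y‖ ^ 2 := by
      rw [← norm_add_sq_real]; congr 2; abel
    linarith
  · filter_upwards [hA_max, hlim] with s hs hls
    have h1 : Tendsto (fun m => ‖x - resolvent (A s) (t m) x‖ₑ) atTop (𝓝 ‖x - Q s‖ₑ) :=
      (hls.const_sub x).enorm
    refine ge_of_tendsto' h1 fun m => ?_
    rw [← edist_eq_enorm_sub]
    exact Metric.infEDist_le_edist_of_mem (hs.resolvent_mem_opDom (ht m) x)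

/-- The displacement of the resolvent is controlled by the distance to the essential domain. -/
theorem norm_safeResolvent_sub_self_le
    (hA_max : ∀ᵐ s ∂μ, IsMaximalMonotoneOp (A s))
    (hA_meas : ∀ t : ℝ, 0 < t → ∀ x : H, Measurable fun s => resolvent (A s) t x)
    {p : ℕ} {C : E → ℝ}
    (hres : ∀ (x : H) (t : ℝ), 0 < t → ∀ᵐ s ∂μ,
      ‖resolvent (A s) t x - proj (closure (opDom (A s))) x‖ ≤ t * C s * (1 + ‖x‖ ^ p))
    (hD : (essDom μ A).Nonempty) (x : H) {t : ℝ} (ht : 0 < t) :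
    ∀ᵐ s ∂μ, ‖safeResolvent A t x s - x‖
      ≤ Metric.infDist x (essDom μ A) + t * C s * (1 + ‖x‖ ^ p) := by
  obtain ⟨Q, -, hQ1, hQ2, -⟩ := exists_limit_resolvent hA_max hA_meas hres x
  have hy : ∀ m : ℕ, ∃ y ∈ essDom μ A,
      dist x y < Metric.infDist x (essDom μ A) + 1 / ((m : ℝ) + 1) := fun m =>
    (Metric.infDist_lt_iff hD).1 (lt_add_of_pos_right _ Nat.one_div_pos_of_nat)
  -- The exceptional set of `hQ2` depends on y, so the infimum is reached along a sequence.
  choose y hyD hy using hy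
  filter_upwards [hQ1 t ht, ae_all_iff.2 fun m => hQ2 (y m) (hyD m)] with s hs1 hs2
  have h1 : ‖x - Q s‖ ≤ Metric.infDist x (essDom μ A) := by
    have h2 : Tendsto (fun m : ℕ => Metric.infDist x (essDom μ A) + 1 / ((m : ℝ) + 1)) atTop
        (𝓝 (Metric.infDist x (essDom μ A) + 0)) :=
      tendsto_one_div_add_atTop_nhds_zero_nat.const_add _
    rw [add_zero] at h2
    refine ge_of_tendsto' h2 fun m => ?_
    have h3 := hs2 m
    have h4 := hy m
    rw [dist_eq_norm] at h4
    have h5 : ‖x - Q s‖ ≤ ‖x - y m‖ := by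
      refine le_of_sq_le_sq ?_ (norm_nonneg _)
      linarith [sq_nonneg ‖Q s - y m‖]
    linarith
  calc ‖safeResolvent A t x s - x‖
      ≤ ‖safeResolvent A t x s - Q s‖ + ‖Q s - x‖ := norm_sub_le_norm_sub_add_norm_sub _ _ _
    _ ≤ _ := by rw [norm_sub_rev (Q s)]; linarith

theorem memLp_norm_safeResolvent_sub [IsProbabilityMeasure μ] [μ.IsComplete]
    (hA_max : ∀ᵐ s ∂μ, IsMaximalMonotoneOp (A s))
    (hA_meas : ∀ t : ℝ, 0 < t → ∀ x : H, Measurable fun s => resolvent (A s) t x)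
    {p : ℕ} {C : E → ℝ} (hC : MemLp C 2 μ)
    (hres : ∀ (x : H) (t : ℝ), 0 < t → ∀ᵐ s ∂μ,
      ‖resolvent (A s) t x - proj (closure (opDom (A s))) x‖ ≤ t * C s * (1 + ‖x‖ ^ p))
    (hD : (essDom μ A).Nonempty) (x y : H) {t : ℝ} (ht : 0 < t) :
    MemLp (fun s => ‖safeResolvent A t x s - y‖) 2 μ := by
  have hm := measurable_safeResolvent hA_max (hA_meas t ht x)
  have h0 : MemLp (fun s => t * C s * (1 + ‖x‖ ^ p)) 2 μ := by
    refine (hC.const_mul (t * (1 + ‖x‖ ^ p))).ae_eq (Eventually.of_forall fun s => ?_)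
    simp only; ring
  have h1 : MemLp (fun s => Metric.infDist x (essDom μ A) + ‖x - y‖
      + t * C s * (1 + ‖x‖ ^ p)) 2 μ :=
    (memLp_const (Metric.infDist x (essDom μ A) + ‖x - y‖)).add h0
  refine h1.mono' ((hm.sub_const y).norm).aestronglyMeasurable ?_
  filter_upwards [norm_safeResolvent_sub_self_le hA_max hA_meas hres hD x ht] with s hs
  rw [norm_norm]
  have := norm_sub_le_norm_sub_add_norm_sub (safeResolvent A t x s) x y
  linarith

theorem memLp_infDist_safeResolvent [IsProbabilityMeasure μ] [μ.IsComplete]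
    (hA_max : ∀ᵐ s ∂μ, IsMaximalMonotoneOp (A s))
    (hA_meas : ∀ t : ℝ, 0 < t → ∀ x : H, Measurable fun s => resolvent (A s) t x)
    {p : ℕ} {C : E → ℝ} (hC : MemLp C 2 μ)
    (hres : ∀ (x : H) (t : ℝ), 0 < t → ∀ᵐ s ∂μ,
      ‖resolvent (A s) t x - proj (closure (opDom (A s))) x‖ ≤ t * C s * (1 + ‖x‖ ^ p))
    (hD : (essDom μ A).Nonempty) (x : H) {t : ℝ} (ht : 0 < t) :
    MemLp (fun s => Metric.infDist (safeResolvent A t x s) (essDom μ A)) 2 μ := by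
  obtain ⟨y, hy⟩ := hD
  refine (memLp_norm_safeResolvent_sub hA_max hA_meas hC hres ⟨y, hy⟩ x y ht).mono'
    (((Metric.continuous_infDist_pt _).measurable.comp
      (measurable_safeResolvent hA_max (hA_meas t ht x))).aestronglyMeasurable)
    (Eventually.of_forall fun s => ?_)
  rw [Real.norm_of_nonneg Metric.infDist_nonneg, ← dist_eq_norm]
  exact Metric.infDist_le_dist_of_mem hy

/-- Under linear regularity, one resolvent step contracts the mean square distance to the
essential domain, up to an error of the order of the squared step. -/
theorem exists_integral_infDist_sq_le [IsProbabilityMeasure μ] [μ.IsComplete]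
    (hA_max : ∀ᵐ s ∂μ, IsMaximalMonotoneOp (A s))
    (hA_meas : ∀ t : ℝ, 0 < t → ∀ x : H, Measurable fun s => resolvent (A s) t x)
    {p : ℕ} {C : E → ℝ} (hC : MemLp C 2 μ)
    (hres : ∀ (x : H) (t : ℝ), 0 < t → ∀ᵐ s ∂μ,
      ‖resolvent (A s) t x - proj (closure (opDom (A s))) x‖ ≤ t * C s * (1 + ‖x‖ ^ p))
    (hD : (essDom μ A).Nonempty) {M κ : ℝ} (hκ : 0 < κ)
    (hreg : ∀ x : H, ‖x‖ ≤ M → ENNReal.ofReal κ * Metric.infEDist x (essDom μ A) ^ 2 ≤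
        ∫⁻ s, Metric.infEDist x (opDom (A s)) ^ 2 ∂μ) :
    ∃ r K : ℝ, 0 ≤ r ∧ r < 1 ∧ 0 < K ∧ ∀ x : H, ‖x‖ ≤ M → ∀ t : ℝ, 0 < t →
      ∫ s, Metric.infDist (safeResolvent A t x s) (essDom μ A) ^ 2 ∂μ
        ≤ (r * Metric.infDist x (essDom μ A)) ^ 2 + (K * t) ^ 2 := by
  set D := essDom μ A
  -- Capping κ at 1 keeps 1 - k / 2 positive.
  set k := min κ 1
  have hk : 0 < k := lt_min hκ one_pos
  have hk1 : k ≤ 1 := min_le_right _ _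
  set L := ∫ s, (C s * (1 + M ^ p)) ^ 2 ∂μ
  have hL : 0 ≤ L := integral_nonneg fun s => sq_nonneg _
  -- Young's inequality with weight k / 2 costs a factor 1 + k / 2, regularity gains 1 - k, and (1 +
  -- k / 2)(1 - k) ≤ 1 - k / 2. The summand 1 under the second root only makes K positive.
  refine ⟨√(1 - k / 2), √((1 + 2 / k) * L + 1), Real.sqrt_nonneg _, ?_, ?_, ?_⟩
  · rw [Real.sqrt_lt' one_pos]; linarith
  · positivity
  intro x hx t ht
  rw [mul_pow, mul_pow, Real.sq_sqrt (by linarith), Real.sq_sqrt (by positivity)]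
  obtain ⟨Q, hQm, hQ1, hQ2, hQ3⟩ := exists_limit_resolvent hA_max hA_meas hres x
  set d := Metric.infDist x D
  set I := ∫ s, Metric.infDist (safeResolvent A t x s) D ^ 2 ∂μ
  have hxQ : ∀ y ∈ D, Integrable (fun s => ‖x - Q s‖ ^ 2) μ := fun y hy => by
    refine (integrable_const (‖x - y‖ ^ 2)).mono'
      ((aestronglyMeasurable_const.sub hQm).norm.pow 2) ?_
    filter_upwards [hQ2 y hy] with s hs
    rw [Real.norm_of_nonneg (sq_nonneg _)]
    linarith [sq_nonneg ‖Q s - y‖]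
  have hkd : k * d ^ 2 ≤ ∫ s, ‖x - Q s‖ ^ 2 ∂μ := by
    obtain ⟨y, hy⟩ := hD
    have h1 : ENNReal.ofReal k * Metric.infEDist x D ^ 2 ≤ ∫⁻ s, ‖x - Q s‖ₑ ^ 2 ∂μ := by
      calc ENNReal.ofReal k * Metric.infEDist x D ^ 2
          ≤ ENNReal.ofReal κ * Metric.infEDist x D ^ 2 := by
            gcongr; exact min_le_left _ _
        _ ≤ ∫⁻ s, Metric.infEDist x (opDom (A s)) ^ 2 ∂μ := hreg x hx
        _ ≤ ∫⁻ s, ‖x - Q s‖ₑ ^ 2 ∂μ := by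
            refine lintegral_mono_ae ?_
            filter_upwards [hQ3] with s hs
            gcongr
    have h2 : ∫⁻ s, ‖x - Q s‖ₑ ^ 2 ∂μ = ENNReal.ofReal (∫ s, ‖x - Q s‖ ^ 2 ∂μ) := by
      rw [ofReal_integral_eq_lintegral_ofReal (hxQ y hy)
        (Eventually.of_forall fun s => sq_nonneg _)]
      refine lintegral_congr fun s => ?_
      rw [ENNReal.ofReal_pow (norm_nonneg _), ofReal_norm]
    have h3 : Metric.infEDist x D = ENNReal.ofReal d :=
      (ENNReal.ofReal_toReal (Metric.infEDist_ne_top ⟨y, hy⟩)).symm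
    rw [h2, h3, ← ENNReal.ofReal_pow Metric.infDist_nonneg, ← ENNReal.ofReal_mul hk.le,
      ENNReal.ofReal_le_ofReal_iff (integral_nonneg fun s => sq_nonneg _)] at h1
    exact h1
  have hy : ∀ y ∈ D, I ≤ (1 + k / 2) * (‖x - y‖ ^ 2 - k * d ^ 2) + (1 + 2 / k) * L * t ^ 2 := by
    intro y hy
    have hCs : Integrable (fun s => (C s * (1 + M ^ p)) ^ 2) μ :=
      (hC.mul_const _).integrable_sq
    have hi0 : Integrable (fun s => (1 + k / 2) * (‖x - y‖ ^ 2 - ‖x - Q s‖ ^ 2)) μ :=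
      ((integrable_const _).sub (hxQ y hy)).const_mul _
    have hi : Integrable (fun s => (1 + k / 2) * (‖x - y‖ ^ 2 - ‖x - Q s‖ ^ 2)
        + (1 + 2 / k) * t ^ 2 * (C s * (1 + M ^ p)) ^ 2) μ :=
      hi0.add (hCs.const_mul _)
    have h1 : I ≤ ∫ s, ((1 + k / 2) * (‖x - y‖ ^ 2 - ‖x - Q s‖ ^ 2)
        + (1 + 2 / k) * t ^ 2 * (C s * (1 + M ^ p)) ^ 2) ∂μ := by
      refine integral_mono_ae
        (memLp_infDist_safeResolvent hA_max hA_meas hC hres hD x ht).integrable_sq hi ?_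
      filter_upwards [hQ1 t ht, hQ2 y hy] with s hs1 hs2
      have h2 : Metric.infDist (safeResolvent A t x s) D ≤ ‖safeResolvent A t x s - Q s‖
          + ‖Q s - y‖ := by
        refine (Metric.infDist_le_dist_of_mem hy).trans ?_
        rw [dist_eq_norm]
        exact norm_sub_le_norm_sub_add_norm_sub _ _ _
      have h3 : ‖safeResolvent A t x s - Q s‖ ≤ t * |C s * (1 + M ^ p)| := by
        refine hs1.trans ?_
        rw [mul_assoc]
        refine mul_le_mul_of_nonneg_left ?_ ht.le
        have hM : ‖x‖ ^ p ≤ M ^ p := pow_le_pow_left₀ (norm_nonneg _) hx _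
        have hM0 : 0 ≤ ‖x‖ ^ p := by positivity
        rw [abs_mul, abs_of_nonneg (show 0 ≤ 1 + M ^ p by linarith)]
        exact mul_le_mul (le_abs_self _) (by linarith) (by linarith) (abs_nonneg _)
      set a := t * |C s * (1 + M ^ p)|
      set b := ‖Q s - y‖
      have ha : a ^ 2 = t ^ 2 * (C s * (1 + M ^ p)) ^ 2 := by
        simp only [a, mul_pow t, sq_abs]
      have h4 : Metric.infDist (safeResolvent A t x s) D ^ 2 ≤ (a + b) ^ 2 :=
        pow_le_pow_left₀ Metric.infDist_nonneg (by linarith) 2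
      have h5 : (a + b) ^ 2 ≤ (1 + k / 2) * b ^ 2 + (1 + 2 / k) * a ^ 2 := by
        have h6 : (1 + k / 2) * b ^ 2 + (1 + 2 / k) * a ^ 2 - (a + b) ^ 2
            = (2 / k) * (k / 2 * b - a) ^ 2 := by
          field_simp; ring
        have h7 : 0 ≤ (2 / k) * (k / 2 * b - a) ^ 2 := by positivity
        linarith
      have h6 : (1 + k / 2) * b ^ 2 ≤ (1 + k / 2) * (‖x - y‖ ^ 2 - ‖x - Q s‖ ^ 2) := by
        gcongr
      rw [ha] at h5
      linarith
    have h2 : ∫ s, ((1 + k / 2) * (‖x - y‖ ^ 2 - ‖x - Q s‖ ^ 2)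
        + (1 + 2 / k) * t ^ 2 * (C s * (1 + M ^ p)) ^ 2) ∂μ
        = (1 + k / 2) * (‖x - y‖ ^ 2 - ∫ s, ‖x - Q s‖ ^ 2 ∂μ) + (1 + 2 / k) * t ^ 2 * L := by
      rw [integral_add hi0 (hCs.const_mul _),
        integral_const_mul, integral_const_mul, integral_sub (integrable_const _) (hxQ y hy)]
      simp [L]
    rw [h2] at h1
    have h3 : (1 + k / 2) * (‖x - y‖ ^ 2 - ∫ s, ‖x - Q s‖ ^ 2 ∂μ)
        ≤ (1 + k / 2) * (‖x - y‖ ^ 2 - k * d ^ 2) := by gcongr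
    linarith
  -- Take the infimum over y ∈ D in `hy`. A nearest point may not exist, so the bound is rewritten
  -- as √W ≤ ‖x - y‖ for all y.
  have hd : (I - (1 + 2 / k) * L * t ^ 2) / (1 + k / 2) + k * d ^ 2 ≤ d ^ 2 := by
    set W := (I - (1 + 2 / k) * L * t ^ 2) / (1 + k / 2) + k * d ^ 2
    have h1 : √W ≤ d := by
      refine (Metric.le_infDist hD).2 fun y hyD => ?_
      rw [dist_eq_norm]
      refine Real.sqrt_le_iff.2 ⟨norm_nonneg _, ?_⟩
      have h2 : (I - (1 + 2 / k) * L * t ^ 2) / (1 + k / 2) ≤ ‖x - y‖ ^ 2 - k * d ^ 2 :=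
        (div_le_iff₀ (by positivity)).2 (by linarith [hy y hyD])
      linarith
    exact (Real.sqrt_le_left Metric.infDist_nonneg).1 h1
  have h1 : I - (1 + 2 / k) * L * t ^ 2 ≤ (d ^ 2 - k * d ^ 2) * (1 + k / 2) :=
    (div_le_iff₀ (by positivity)).1 (by linarith)
  nlinarith [sq_nonneg (k * d), sq_nonneg t]

end RandomResolvent

/-! ### Quasi-Fejér convergence of the distances to a zero -/

theorem ae_summable_of_summable_integral {Ω : Type*} [MeasurableSpace Ω] {P : Measure Ω}
    {f : ℕ → Ω → ℝ} (hf0 : ∀ n ω, 0 ≤ f n ω) (hf : ∀ n, Integrable (f n) P)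
    (hs : Summable fun n => ∫ ω, f n ω ∂P) : ∀ᵐ ω ∂P, Summable fun n => f n ω := by
  have h1 : ∫⁻ ω, ∑' n, ENNReal.ofReal (f n ω) ∂P < ∞ := by
    rw [lintegral_tsum fun n => (hf n).aemeasurable.ennreal_ofReal]
    simp_rw [← fun n => ofReal_integral_eq_lintegral_ofReal (hf n)
      (Eventually.of_forall (hf0 n))]
    exact hs.tsum_ofReal_lt_top
  filter_upwards [ae_lt_top' (AEMeasurable.tsum fun n =>
    (hf n).aemeasurable.ennreal_ofReal) h1.ne] with ω hω
  have h2 := ENNReal.summable_toReal hω.ne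
  exact h2.congr fun n => ENNReal.toReal_ofReal (hf0 n ω)

/-- A nonnegative sequence decreasing up to a convergent perturbation converges. -/
theorem exists_tendsto_of_le_sub {e a : ℕ → ℝ} (he : ∀ n, 0 ≤ e n)
    (h : ∀ n, e (n + 1) ≤ e n - a n) {L : ℝ}
    (ha : Tendsto (fun n => ∑ k ∈ Finset.range n, a k) atTop (𝓝 L)) :
    ∃ L', Tendsto e atTop (𝓝 L') := by
  have hanti : Antitone fun n => e n + ∑ k ∈ Finset.range n, a k :=
    antitone_nat_of_succ_le fun n => by
      rw [Finset.sum_range_succ]; linarith [h n]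
  obtain ⟨m, hm⟩ := ha.bddBelow_range
  have hbdd : BddBelow (Set.range fun n => e n + ∑ k ∈ Finset.range n, a k) := by
    refine ⟨m, ?_⟩
    rintro _ ⟨n, rfl⟩
    have := hm ⟨n, rfl⟩
    simp only at this ⊢
    linarith [he n]
  refine ⟨_, ((tendsto_atTop_ciInf hanti hbdd).sub ha).congr fun n => ?_⟩
  ring

section Iteration

variable {Ω : Type*} [mΩ : MeasurableSpace Ω]
variable {E : Type*} [MeasurableSpace E]
variable {H : Type*} [MeasurableSpace H]

/-- The process `X` is obtained from a deterministic point by applying measurable maps `J n`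
to the innovations `η n`, which have law `μ` and are independent of the past. -/
structure IsRandomIteration (P : Measure Ω) (μ : Measure E) (ℱ : Filtration ℕ mΩ)
    (η : ℕ → Ω → E) (J : ℕ → H → E → H) (X : ℕ → Ω → H) : Prop where
  measurable_innovation : ∀ n, Measurable[ℱ (n + 1)] (η n)
  law : ∀ n, P.map (η n) = μ
  indep : ∀ n, Indep (ℱ n) (MeasurableSpace.comap (η n) inferInstance) P
  measurable_map : ∀ n, Measurable (Function.uncurry (J n))
  adapted : ∀ n, Measurable[ℱ n] (X n)
  start : ∃ x₀, ∀ ω, X 0 ω = x₀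
  step : ∀ n ω, X (n + 1) ω = J n (X n ω) (η n ω)

variable {P : Measure Ω} {μ : Measure E}
variable {ℱ : Filtration ℕ mΩ} {η : ℕ → Ω → E} {J : ℕ → H → E → H} {X : ℕ → Ω → H}

theorem IsRandomIteration.measurable_eta (hI : IsRandomIteration P μ ℱ η J X) (n : ℕ) :
    Measurable (η n) := (hI.measurable_innovation n).mono (ℱ.le _) le_rfl

theorem IsRandomIteration.measurable (hI : IsRandomIteration P μ ℱ η J X) (n : ℕ) :
    Measurable (X n) := (hI.adapted n).mono (ℱ.le _) le_rfl

theorem IsRandomIteration.indepFun {α : Type*} [MeasurableSpace α]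
    (hI : IsRandomIteration P μ ℱ η J X) {n : ℕ} {Y : Ω → α} (hY : Measurable[ℱ n] Y) :
    IndepFun Y (η n) P := by
  rw [IndepFun_iff_Indep]
  exact indep_of_indep_of_le_left (hI.indep n) hY.comap_le

theorem IsRandomIteration.ae_eta (hI : IsRandomIteration P μ ℱ η J X) {p : E → Prop}
    (hp : ∀ᵐ s ∂μ, p s) : ∀ᵐ ω ∂P, ∀ n, p (η n ω) :=
  ae_all_iff.2 fun n => ae_of_ae_map (hI.measurable_eta n).aemeasurable (by rwa [hI.law n])

variable [IsProbabilityMeasure P] [IsProbabilityMeasure μ]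
variable [NormedAddCommGroup H] [InnerProductSpace ℝ H] [BorelSpace H]
  [SecondCountableTopology H] [CompleteSpace H]

/-- Quasi-Fejér monotonicity: if the maps `J n` satisfy the proximal inequality at `z` with a
square-integrable centered `φ`, the distance of the iterates to `z` converges almost surely. -/
theorem IsRandomIteration.ae_tendsto_norm_sub (hI : IsRandomIteration P μ ℱ η J X)
    {l : ℕ → ℝ} (hl : Summable fun n => l n ^ 2) {z : H} {φ : E → H} (hφm : Measurable φ)
    (hφ2 : MemLp φ 2 μ) (hφ0 : ∫ s, φ s ∂μ = 0)
    (hstep : ∀ᵐ s ∂μ, ∀ n x, ‖J n x s - z‖ ^ 2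
      ≤ ‖x - z‖ ^ 2 - 2 * l n * inner ℝ (φ s) (x - z) + l n ^ 2 * ‖φ s‖ ^ 2) :
    ∀ᵐ ω ∂P, ∃ L, Tendsto (fun n => ‖X n ω - z‖) atTop (𝓝 L) := by
  have hφ1 : Integrable φ μ := hφ2.integrable one_le_two
  have hφsq : Integrable (fun s => ‖φ s‖ ^ 2) μ :=
    (memLp_two_iff_integrable_sq_norm hφm.aestronglyMeasurable).1 hφ2
  set V := ∫ s, ‖φ s‖ ^ 2 ∂μ
  have hV : 0 ≤ V := integral_nonneg fun s => sq_nonneg _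
  let F : ℕ → H → E → ℝ := fun n a s => l n * inner ℝ (φ s) (a - z)
  have hFm : ∀ n, Measurable (Function.uncurry (F n)) := fun n =>
    ((hφm.comp measurable_snd).inner (measurable_fst.sub_const z)).const_mul (l n)
  have hF2 : ∀ n a, MemLp (F n a) 2 μ := fun n a => (hφ2.inner_const (a - z)).const_mul (l n)
  have hF0 : ∀ n a, ∫ s, F n a s ∂μ = 0 := fun n a => by
    simp only [F]
    rw [integral_const_mul]
    have h1 : ∫ s, inner ℝ (φ s) (a - z) ∂μ = inner ℝ (∫ s, φ s ∂μ) (a - z) := by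
      simp_rw [real_inner_comm (a - z)]
      exact integral_inner hφ1 _
    rw [h1, hφ0, inner_zero_left, mul_zero]
  set e : ℕ → Ω → ℝ := fun n ω => ‖X n ω - z‖ ^ 2
  have hem : ∀ n, Measurable (e n) := fun n => ((hI.measurable n).sub_const z).norm.pow_const 2
  have hes : ∀ᵐ ω ∂P, ∀ n, e (n + 1) ω
      ≤ e n ω - 2 * F n (X n ω) (η n ω) + l n ^ 2 * ‖φ (η n ω)‖ ^ 2 := by
    filter_upwards [hI.ae_eta hstep] with ω hω n
    have := hω n n (X n ω)
    simp only [e, hI.step, F]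
    linarith
  have hφη : ∀ n, Integrable (fun ω => ‖φ (η n ω)‖ ^ 2) P := fun n => by
    have := hφsq
    rw [← hI.law n, integrable_map_measure (hφm.norm.pow_const 2).aestronglyMeasurable
      (hI.measurable_eta n).aemeasurable] at this
    exact this
  have hφηV : ∀ n, ∫ ω, ‖φ (η n ω)‖ ^ 2 ∂P = V := fun n => by
    simp only [V]
    rw [← hI.law n, integral_map (hI.measurable_eta n).aemeasurable
      (hφm.norm.pow_const 2).aestronglyMeasurable]
  -- The bound ‖X n - z‖ ≤ 1 + ‖X n - z‖² controls the first moment by `e n`; integrability of `e`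
  -- then propagates by induction.
  have hFint : ∀ n, Integrable (e n) P → Integrable (fun ω => F n (X n ω) (η n ω)) P := by
    intro n hn
    have hg : Integrable (fun ω => |l n| * (∫ s, ‖φ s‖ ∂μ) * (1 + e n ω)) P :=
      ((integrable_const _).add hn).const_mul _
    refine integrable_comp_of_indepFun (hI.measurable n) (hI.measurable_eta n) (hI.law n)
      (hI.indepFun (hI.adapted n)) (hFm n) (fun a => (hF2 n a).integrable one_le_two) hg
      fun ω => ?_
    have h1 : ∀ s, |F n (X n ω) s| ≤ |l n| * (1 + e n ω) * ‖φ s‖ := fun s => by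
      simp only [F, abs_mul]
      have h2 := abs_real_inner_le_norm (φ s) (X n ω - z)
      have h3 : ‖X n ω - z‖ ≤ 1 + e n ω := by
        simp only [e]; nlinarith [sq_nonneg (‖X n ω - z‖ - 1), norm_nonneg (X n ω - z)]
      have h4 : ‖φ s‖ * ‖X n ω - z‖ ≤ ‖φ s‖ * (1 + e n ω) := by gcongr
      calc |l n| * |inner ℝ (φ s) (X n ω - z)| ≤ |l n| * (‖φ s‖ * (1 + e n ω)) := by
            gcongr; exact h2.trans h4
        _ = _ := by ring
    calc ∫ s, |F n (X n ω) s| ∂μ ≤ ∫ s, |l n| * (1 + e n ω) * ‖φ s‖ ∂μ :=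
          integral_mono ((hF2 n _).integrable one_le_two).abs (hφ1.norm.const_mul _) h1
      _ = _ := by rw [integral_const_mul]; ring
  have hei : ∀ n, Integrable (e n) P := by
    intro n
    induction n with
    | zero =>
      obtain ⟨x₀, hx₀⟩ := hI.start
      simp only [e, hx₀]
      exact integrable_const _
    | succ n ih =>
      have h1 : Integrable (fun ω => e n ω - 2 * F n (X n ω) (η n ω)
          + l n ^ 2 * ‖φ (η n ω)‖ ^ 2) P :=
        (ih.sub ((hFint n ih).const_mul 2)).add ((hφη n).const_mul _)
      refine h1.mono' (hem _).aestronglyMeasurable ?_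
      filter_upwards [hes] with ω hω
      rw [Real.norm_of_nonneg (sq_nonneg _)]
      exact hω n
  have hle : ∀ n, ∫ ω, e (n + 1) ω ∂P ≤ ∫ ω, e n ω ∂P + l n ^ 2 * V := by
    intro n
    have h0 : Integrable (fun ω => e n ω - 2 * F n (X n ω) (η n ω)) P :=
      (hei n).sub ((hFint n (hei n)).const_mul 2)
    have h1 : ∫ ω, e (n + 1) ω ∂P ≤ ∫ ω, (e n ω - 2 * F n (X n ω) (η n ω)
          + l n ^ 2 * ‖φ (η n ω)‖ ^ 2) ∂P :=
      integral_mono_ae (hei _) (h0.add ((hφη n).const_mul _))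
        (hes.mono fun ω hω => hω n)
    have h2 : ∫ ω, F n (X n ω) (η n ω) ∂P = 0 := by
      rw [integral_comp_of_indepFun (hI.measurable n) (hI.measurable_eta n) (hI.law n)
        (hI.indepFun (hI.adapted n)) (hFm n) (hFint n (hei n))]
      simp only [hF0, integral_zero]
    rw [integral_add h0 ((hφη n).const_mul _), integral_sub (hei n)
      ((hFint n (hei n)).const_mul 2), integral_const_mul (2 : ℝ) (fun ω => F n (X n ω) (η n ω)),
      integral_const_mul (l n ^ 2), hφηV, h2] at h1
    linarith
  -- A bound uniform in n makes the second moments of the increments, at most l_n² V E[e n],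
  -- summable.
  have hbd : ∀ n, ∫ ω, e n ω ∂P ≤ ∫ ω, e 0 ω ∂P + (∑' k, l k ^ 2) * V := by
    intro n
    have h1 : ∀ n, ∫ ω, e n ω ∂P ≤ ∫ ω, e 0 ω ∂P + (∑ k ∈ Finset.range n, l k ^ 2) * V := by
      intro n
      induction n with
      | zero => simp
      | succ n ih => rw [Finset.sum_range_succ, add_mul]; linarith [hle n]
    refine (h1 n).trans ?_
    gcongr
    exact hl.sum_le_tsum _ fun k _ => sq_nonneg _
  have hmg := ae_tendsto_sum_of_centered (P := P) hI.measurable_innovation hI.law hI.indep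
    hI.adapted hFm hF2 hF0 (g := fun n ω => l n ^ 2 * V * e n ω) (fun n => (hei n).const_mul _)
    (fun n ω => by
      calc ∫ s, F n (X n ω) s ^ 2 ∂μ ≤ ∫ s, l n ^ 2 * e n ω * ‖φ s‖ ^ 2 ∂μ := by
            refine integral_mono (hF2 n _).integrable_sq (hφsq.const_mul _) fun s => ?_
            simp only [F, e]
            rw [mul_pow, mul_assoc]
            gcongr
            rw [← mul_pow, ← sq_abs, mul_comm]
            exact pow_le_pow_left₀ (abs_nonneg _) (abs_real_inner_le_norm _ _) 2
        _ = l n ^ 2 * V * e n ω := by rw [integral_const_mul]; ring)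
    (by
      simp_rw [integral_const_mul]
      refine Summable.of_nonneg_of_le (fun n => ?_) (fun n => ?_)
        ((hl.mul_right V).mul_right (∫ ω, e 0 ω ∂P + (∑' k, l k ^ 2) * V))
      · exact mul_nonneg (by positivity) (integral_nonneg fun ω => sq_nonneg _)
      · exact mul_le_mul_of_nonneg_left (hbd n) (by positivity))
  have hsm : ∀ᵐ ω ∂P, Summable fun n => l n ^ 2 * ‖φ (η n ω)‖ ^ 2 := by
    refine ae_summable_of_summable_integral (fun n ω => by positivity)
      (fun n => (hφη n).const_mul _) ?_
    simp_rw [integral_const_mul, hφηV]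
    exact hl.mul_right V
  filter_upwards [hmg, hsm, hes] with ω ⟨L, hL⟩ hs he
  have ht := (hL.const_mul 2).sub hs.hasSum.tendsto_sum_nat
  have ht' : Tendsto (fun n => ∑ k ∈ Finset.range n,
      (2 * F k (X k ω) (η k ω) - l k ^ 2 * ‖φ (η k ω)‖ ^ 2)) atTop
      (𝓝 (2 * L - ∑' n, l n ^ 2 * ‖φ (η n ω)‖ ^ 2)) := by
    refine ht.congr fun n => ?_
    rw [Finset.sum_sub_distrib, Finset.mul_sum]
  obtain ⟨L', hL'⟩ := exists_tendsto_of_le_sub (e := fun n => e n ω) (fun n => sq_nonneg _)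
    (fun n => by linarith [he n]) ht'
  exact ⟨√L', hL'.sqrt.congr fun n => Real.sqrt_sq (norm_nonneg _)⟩

end Iteration

/-! ### Localized estimates on the event that the iterates stay in a ball -/

section Localization

variable {Ω : Type*} [mΩ : MeasurableSpace Ω]
variable {E : Type*} [MeasurableSpace E]
variable {H : Type*} [MeasurableSpace H]
variable [NormedAddCommGroup H]

/-- The indicator of the event that the first iterates `X 0, …, X n` have norm at most `M`. -/
noncomputable def bddInd (X : ℕ → Ω → H) (M : ℝ) (n : ℕ) : Ω → ℝ :=
  {ω | ∀ k ≤ n, ‖X k ω‖ ≤ M}.indicator 1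

section Basic

variable {X : ℕ → Ω → H} {M : ℝ}

omit mΩ [MeasurableSpace H] in
theorem bddInd_eq (n : ℕ) (ω : Ω) :
    bddInd X M n ω = 0 ∨ (bddInd X M n ω = 1 ∧ ‖X n ω‖ ≤ M) := by
  by_cases h : ω ∈ {ω | ∀ k ≤ n, ‖X k ω‖ ≤ M}
  · exact Or.inr ⟨Set.indicator_of_mem h _, h n le_rfl⟩
  · exact Or.inl (Set.indicator_of_notMem h _)

omit mΩ [MeasurableSpace H] in
theorem bddInd_nonneg (n : ℕ) (ω : Ω) : 0 ≤ bddInd X M n ω := by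
  rcases bddInd_eq (X := X) (M := M) n ω with h | ⟨h, -⟩ <;> simp [h]

-- Lets the localization at time n + 1 be replaced by the one at time n, which is known before the
-- innovation is drawn.
omit mΩ [MeasurableSpace H] in
theorem bddInd_succ_le (n : ℕ) (ω : Ω) : bddInd X M (n + 1) ω ≤ bddInd X M n ω :=
  Set.indicator_le_indicator_of_subset
    (Set.ofPred_subset_ofPred.2 fun _ h k hk => h k (hk.trans n.le_succ)) (fun _ => zero_le_one) ω

omit mΩ [MeasurableSpace H] in
theorem bddInd_of_forall {ω : Ω} (h : ∀ k, ‖X k ω‖ ≤ M) (n : ℕ) : bddInd X M n ω = 1 :=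
  Set.indicator_of_mem (show ω ∈ {ω | ∀ k ≤ n, ‖X k ω‖ ≤ M} from fun k _ => h k) _

theorem measurable_bddInd [BorelSpace H] {ℱ : Filtration ℕ mΩ} (hX : ∀ n, Measurable[ℱ n] (X n))
    (n : ℕ) : Measurable[ℱ n] (bddInd X M n) := by
  refine measurable_const.indicator ?_
  have : {ω | ∀ k ≤ n, ‖X k ω‖ ≤ M} = ⋂ k ∈ Set.Iic n, {ω | ‖X k ω‖ ≤ M} := by
    ext ω; simp
  rw [this]
  refine MeasurableSet.biInter (Set.to_countable _) fun k hk => ?_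
  exact (measurable_norm.comp ((hX k).mono (ℱ.mono hk) le_rfl)) measurableSet_Iic

end Basic

/-- Integrate the pointwise bound f ≤ a / 2 + f² / (2a). -/
theorem integral_le_of_integral_sq_le {μ : Measure E} [IsProbabilityMeasure μ] {f : E → ℝ}
    (hf : MemLp f 2 μ) {a : ℝ} (ha : 0 < a) (h : ∫ s, f s ^ 2 ∂μ ≤ a ^ 2) :
    ∫ s, f s ∂μ ≤ a := by
  have h1 : ∫ s, f s ∂μ ≤ ∫ s, (a / 2 + (2 * a)⁻¹ * f s ^ 2) ∂μ := by
    refine integral_mono (hf.integrable one_le_two)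
      ((integrable_const _).add (hf.integrable_sq.const_mul _)) fun s => ?_
    have h2 : a / 2 + (2 * a)⁻¹ * f s ^ 2 - f s = (2 * a)⁻¹ * (f s - a) ^ 2 := by
      field_simp; ring
    have h3 : 0 ≤ (2 * a)⁻¹ * (f s - a) ^ 2 := by positivity
    simp only
    linarith
  rw [integral_add (integrable_const _) (hf.integrable_sq.const_mul _), integral_const_mul] at h1
  have h4 : (2 * a)⁻¹ * ∫ s, f s ^ 2 ∂μ ≤ (2 * a)⁻¹ * a ^ 2 := by gcongr
  have h5 : (2 * a)⁻¹ * a ^ 2 = a / 2 := by field_simp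
  simp only [integral_const, probReal_univ, smul_eq_mul, one_mul] at h1
  linarith

variable {P : Measure Ω} {μ : Measure E} [IsProbabilityMeasure P] [IsProbabilityMeasure μ]
variable [BorelSpace H]
variable {ℱ : Filtration ℕ mΩ} {η : ℕ → Ω → E} {J : ℕ → H → E → H} {X : ℕ → Ω → H}

/-- If the maps `J n` contract the mean square distance to `D` up to `O(l n ^ 2)`, then the
localized square distances of the iterates to `D` are summable in mean, and the localized
distances sum to at most a multiple of the sum of the steps. -/
theorem IsRandomIteration.sum_infDist_le (hI : IsRandomIteration P μ ℱ η J X)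
    {l : ℕ → ℝ} (hl0 : ∀ n, 0 < l n) (hl : Summable fun n => l n ^ 2) {D : Set H}
    (hD : D.Nonempty) (hJD : ∀ n a, MemLp (fun s => Metric.infDist (J n a s) D) 2 μ)
    {M r K : ℝ} (hr0 : 0 ≤ r) (hr1 : r < 1) (hK : 0 < K)
    (hJ : ∀ n a, ‖a‖ ≤ M → ∫ s, Metric.infDist (J n a s) D ^ 2 ∂μ
      ≤ (r * Metric.infDist a D) ^ 2 + (K * l n) ^ 2) :
    (∀ n, Integrable (fun ω => bddInd X M n ω * Metric.infDist (X n ω) D ^ 2) P) ∧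
    (Summable fun n => ∫ ω, bddInd X M n ω * Metric.infDist (X n ω) D ^ 2 ∂P) ∧
    ∀ᵐ ω ∂P, ∃ B, ∀ n, ∑ k ∈ Finset.range n, bddInd X M k ω * Metric.infDist (X k ω) D
      ≤ B + K / (1 - r) * ∑ k ∈ Finset.range n, l k := by
  set τ := bddInd X M
  have hτm : ∀ n, Measurable[ℱ n] (τ n) := measurable_bddInd hI.adapted
  have hdm : Measurable fun a : H => Metric.infDist a D :=
    (Metric.continuous_infDist_pt D).measurable
  have hvm : ∀ n, Measurable fun ω => τ n ω * Metric.infDist (X n ω) D ^ 2 := fun n =>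
    ((hτm n).mono (ℱ.le _) le_rfl).mul ((hdm.comp (hI.measurable n)).pow_const 2)
  obtain ⟨y, hy⟩ := hD
  have hvi : ∀ n, Integrable (fun ω => τ n ω * Metric.infDist (X n ω) D ^ 2) P := by
    intro n
    refine (integrable_const ((M + ‖y‖) ^ 2)).mono' (hvm n).aestronglyMeasurable
      (Eventually.of_forall fun ω => ?_)
    rw [Real.norm_of_nonneg (mul_nonneg (bddInd_nonneg n ω) (sq_nonneg _))]
    rcases bddInd_eq (X := X) (M := M) n ω with h | ⟨h, hM⟩
    · simp only [h]; nlinarith [sq_nonneg (M + ‖y‖)]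
    · simp only [h, one_mul]
      refine pow_le_pow_left₀ Metric.infDist_nonneg ?_ 2
      refine (Metric.infDist_le_dist_of_mem hy).trans ?_
      rw [dist_eq_norm]
      linarith [norm_sub_le (X n ω) y]
  -- The localizing factor joins the state, so the pair (X n, τ n) is the adapted process to which
  -- the martingale lemma applies.
  let F : ℕ → H × ℝ → E → ℝ := fun n a s => a.2 * Metric.infDist (J n a.1 s) D
  have hFm : ∀ n, Measurable (Function.uncurry (F n)) := by
    intro n
    have h1 : Measurable fun p : (H × ℝ) × E => J n p.1.1 p.2 :=
      (hI.measurable_map n).comp ((measurable_fst.comp measurable_fst).prodMk measurable_snd)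
    exact (measurable_snd.comp measurable_fst).mul (hdm.comp h1)
  have hF2 : ∀ n a, MemLp (F n a) 2 μ := fun n a => (hJD n a.1).const_mul a.2
  have hXτ : ∀ n, Measurable[ℱ n] fun ω => (X n ω, τ n ω) := fun n =>
    (hI.adapted n).prodMk (hτm n)
  set g : ℕ → Ω → ℝ := fun n ω =>
    r ^ 2 * (τ n ω * Metric.infDist (X n ω) D ^ 2) + (K * l n) ^ 2
  have hFg : ∀ n ω, ∫ s, F n (X n ω, τ n ω) s ^ 2 ∂μ ≤ g n ω := by
    intro n ω
    simp only [F, g, mul_pow, integral_const_mul]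
    rcases bddInd_eq (X := X) (M := M) n ω with h | ⟨h, hM⟩
    · simp only [τ, h]; nlinarith [mul_nonneg (sq_nonneg K) (sq_nonneg (l n))]
    · simp only [τ, h]
      have := hJ n _ hM
      rw [mul_pow, mul_pow] at this
      linarith
  have hgi : ∀ n, Integrable (g n) P := fun n => ((hvi n).const_mul _).add (integrable_const _)
  have hgint : ∀ n, ∫ ω, g n ω ∂P
      = r ^ 2 * ∫ ω, τ n ω * Metric.infDist (X n ω) D ^ 2 ∂P + (K * l n) ^ 2 := fun n => by
    simp only [g]
    rw [integral_add ((hvi n).const_mul _) (integrable_const _), integral_const_mul]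
    simp
  have hKl : Summable fun n => (K * l n) ^ 2 := by
    simp_rw [mul_pow]; exact hl.mul_left _
  -- The mean localized square distance v satisfies v_{n+1} ≤ r² v_n + (K l_n)².
  have hvs : Summable fun n => ∫ ω, τ n ω * Metric.infDist (X n ω) D ^ 2 ∂P := by
    refine summable_of_le_mul_add (r := r ^ 2) (b := fun n => (K * l n) ^ 2) (fun n => ?_)
      (by nlinarith) (fun n => sq_nonneg _) hKl fun n => ?_
    · exact integral_nonneg fun ω => mul_nonneg (bddInd_nonneg n ω) (sq_nonneg _)
    · have hm : Measurable fun ω => (X n ω, τ n ω) := (hXτ n).mono (ℱ.le _) le_rfl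
      have hF2m : Measurable (Function.uncurry fun a s => F n a s ^ 2) := (hFm n).pow_const 2
      have hi : Integrable (fun ω => F n (X n ω, τ n ω) (η n ω) ^ 2) P :=
        integrable_comp_of_indepFun (F := fun a s => F n a s ^ 2) hm (hI.measurable_eta n)
          (hI.law n) (hI.indepFun (hXτ n)) hF2m (fun a => (hF2 n a).integrable_sq) (hgi n)
          fun ω => by simpa only [abs_sq] using hFg n ω
      have he := integral_comp_of_indepFun (F := fun a s => F n a s ^ 2) hm
        (hI.measurable_eta n) (hI.law n) (hI.indepFun (hXτ n)) hF2m hi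
      rw [← hgint]
      calc ∫ ω, τ (n + 1) ω * Metric.infDist (X (n + 1) ω) D ^ 2 ∂P
          ≤ ∫ ω, F n (X n ω, τ n ω) (η n ω) ^ 2 ∂P := by
            refine integral_mono (hvi _) hi fun ω => ?_
            simp only [F, ← hI.step, mul_pow]
            gcongr
            have h1 := bddInd_succ_le (X := X) (M := M) n ω
            rcases bddInd_eq (X := X) (M := M) n ω with h | ⟨h, -⟩ <;>
              simp only [τ, h] at h1 ⊢ <;> linarith
        _ = _ := he
        _ ≤ ∫ ω, g n ω ∂P := by
            refine integral_mono_of_nonneg (Eventually.of_forall fun ω =>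
              integral_nonneg fun s => sq_nonneg _) (hgi n) (Eventually.of_forall (hFg n))
  refine ⟨hvi, hvs, ?_⟩
  have hgs : Summable fun n => ∫ ω, g n ω ∂P := by
    simp_rw [hgint]; exact (hvs.mul_left _).add hKl
  filter_upwards [ae_tendsto_sum_sub_integral (P := P) hI.measurable_innovation hI.law hI.indep
    hXτ hFm hF2 hgi hFg hgs] with ω ⟨L, hL⟩
  obtain ⟨B, hB⟩ := hL.bddAbove_range
  -- Up to a convergent martingale, the localized distances satisfy d_{k+1} ≤ r d_k + K l_k; summing
  -- and absorbing r ∑ d_k divides by 1 - r.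
  refine ⟨(τ 0 ω * Metric.infDist (X 0 ω) D + B) / (1 - r), fun n => ?_⟩
  have hB' := hB ⟨n, rfl⟩
  simp only at hB'
  have h1 : ∀ k, τ (k + 1) ω * Metric.infDist (X (k + 1) ω) D
      ≤ (F k (X k ω, τ k ω) (η k ω) - ∫ s, F k (X k ω, τ k ω) s ∂μ)
        + (r * (τ k ω * Metric.infDist (X k ω) D) + K * l k) := by
    intro k
    have h2 : τ (k + 1) ω * Metric.infDist (X (k + 1) ω) D ≤ F k (X k ω, τ k ω) (η k ω) := by
      simp only [F, ← hI.step]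
      exact mul_le_mul_of_nonneg_right (bddInd_succ_le k ω) Metric.infDist_nonneg
    have h3 : ∫ s, F k (X k ω, τ k ω) s ∂μ
        ≤ r * (τ k ω * Metric.infDist (X k ω) D) + K * l k := by
      have hd : 0 ≤ Metric.infDist (X k ω) D := Metric.infDist_nonneg
      have hKlk := mul_pos hK (hl0 k)
      simp only [F, integral_const_mul]
      rcases bddInd_eq (X := X) (M := M) k ω with h | ⟨h, hM⟩
      · simp only [τ, h]; linarith
      · simp only [τ, h, one_mul]
        have hrd := mul_nonneg hr0 hd
        refine integral_le_of_integral_sq_le (hJD k _) (by linarith) ((hJ k _ hM).trans ?_)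
        nlinarith
    linarith
  have h2 := Finset.sum_le_sum fun k (_ : k ∈ Finset.range n) => h1 k
  rw [Finset.sum_add_distrib, Finset.sum_add_distrib, ← Finset.mul_sum, ← Finset.mul_sum] at h2
  have h3 := Finset.sum_range_succ (fun k => τ k ω * Metric.infDist (X k ω) D) n
  have h4 := Finset.sum_range_succ' (fun k => τ k ω * Metric.infDist (X k ω) D) n
  have h5 : 0 ≤ τ n ω * Metric.infDist (X n ω) D :=
    mul_nonneg (bddInd_nonneg n ω) Metric.infDist_nonneg
  rw [div_mul_eq_mul_div, ← add_div, le_div_iff₀ (by linarith)]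
  linarith

variable [SecondCountableTopology H]

/-- The displacements of the iterates at the times when the innovation falls in `B` have a
localized sum at most of the order of the sum of the steps, with a small factor when `B` is
small. -/
theorem IsRandomIteration.sum_indicator_displacement_le (hI : IsRandomIteration P μ ℱ η J X)
    {l : ℕ → ℝ} (hl0 : ∀ n, 0 < l n) (hl : Summable fun n => l n ^ 2) {D : Set H}
    {p : ℕ} {C : E → ℝ} (hC : MemLp C 2 μ) (hC0 : ∀ s, 0 ≤ C s)
    (hJ2 : ∀ n a, MemLp (fun s => ‖J n a s - a‖) 2 μ)
    (hJ : ∀ n a, ∀ᵐ s ∂μ, ‖J n a s - a‖ ≤ Metric.infDist a D + l n * C s * (1 + ‖a‖ ^ p))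
    {M : ℝ} (hM0 : 0 ≤ M)
    (hvi : ∀ n, Integrable (fun ω => bddInd X M n ω * Metric.infDist (X n ω) D ^ 2) P)
    (hvs : Summable fun n => ∫ ω, bddInd X M n ω * Metric.infDist (X n ω) D ^ 2 ∂P)
    {B : Set E} (hB : MeasurableSet B) :
    ∀ᵐ ω ∂P, ∃ b, ∀ n, ∑ k ∈ Finset.range n,
        bddInd X M k ω * B.indicator 1 (η k ω) * ‖X (k + 1) ω - X k ω‖
      ≤ b + μ.real B * ∑ k ∈ Finset.range n, bddInd X M k ω * Metric.infDist (X k ω) D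
        + (1 + M ^ p) * (∫ s in B, C s ∂μ) * ∑ k ∈ Finset.range n, l k := by
  set τ := bddInd X M
  have hτm : ∀ n, Measurable[ℱ n] (τ n) := measurable_bddInd hI.adapted
  let F : ℕ → H × ℝ → E → ℝ := fun n a s => a.2 * B.indicator 1 s * ‖J n a.1 s - a.1‖
  have hFm : ∀ n, Measurable (Function.uncurry (F n)) := by
    intro n
    have h1 : Measurable fun p : (H × ℝ) × E => J n p.1.1 p.2 :=
      (hI.measurable_map n).comp ((measurable_fst.comp measurable_fst).prodMk measurable_snd)
    have h2 : Measurable fun p : (H × ℝ) × E => B.indicator (1 : E → ℝ) p.2 :=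
      (measurable_const.indicator hB).comp measurable_snd
    exact ((measurable_snd.comp measurable_fst).mul h2).mul
      (h1.sub (measurable_fst.comp measurable_fst)).norm
  have hFeq : ∀ n a, F n a = B.indicator fun s => a.2 * ‖J n a.1 s - a.1‖ := fun n a => by
    ext s; by_cases h : s ∈ B <;> simp [F, h]
  have hF2 : ∀ n a, MemLp (F n a) 2 μ := fun n a => by
    rw [hFeq]; exact ((hJ2 n a.1).const_mul a.2).indicator hB
  have hXτ : ∀ n, Measurable[ℱ n] fun ω => (X n ω, τ n ω) := fun n =>
    (hI.adapted n).prodMk (hτm n)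
  set V := ∫ s, C s ^ 2 ∂μ
  have hV : 0 ≤ V := integral_nonneg fun s => sq_nonneg _
  have hJM : ∀ n ω, ‖X n ω‖ ≤ M → ∀ᵐ s ∂μ, ‖J n (X n ω) s - X n ω‖
      ≤ Metric.infDist (X n ω) D + l n * (1 + M ^ p) * C s := by
    intro n ω hM
    filter_upwards [hJ n (X n ω)] with s hs
    have h1 : ‖X n ω‖ ^ p ≤ M ^ p := pow_le_pow_left₀ (norm_nonneg _) hM _
    have h2 : l n * C s * (1 + ‖X n ω‖ ^ p) ≤ l n * C s * (1 + M ^ p) :=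
      mul_le_mul_of_nonneg_left (by linarith) (mul_nonneg (hl0 n).le (hC0 s))
    linarith
  -- From (d + u)² ≤ 2d² + 2u² with u = l_n (1 + M^p) C; summable in mean by `hvs` and `hl`.
  set g : ℕ → Ω → ℝ := fun n ω => 2 * (τ n ω * Metric.infDist (X n ω) D ^ 2)
    + l n ^ 2 * (2 * (1 + M ^ p) ^ 2 * V)
  have hFg : ∀ n ω, ∫ s, F n (X n ω, τ n ω) s ^ 2 ∂μ ≤ g n ω := by
    intro n ω
    rcases bddInd_eq (X := X) (M := M) n ω with h | ⟨h, hM⟩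
    · simp only [F, g, τ, h]; simp only [zero_mul, ne_eq, OfNat.ofNat_ne_zero,
        not_false_eq_true, zero_pow, integral_zero, mul_zero, zero_add]; positivity
    · have hi : Integrable (fun s => 2 * Metric.infDist (X n ω) D ^ 2
          + 2 * (l n * (1 + M ^ p)) ^ 2 * C s ^ 2) μ :=
        (integrable_const _).add (hC.integrable_sq.const_mul _)
      calc ∫ s, F n (X n ω, τ n ω) s ^ 2 ∂μ
          ≤ ∫ s, (2 * Metric.infDist (X n ω) D ^ 2
            + 2 * (l n * (1 + M ^ p)) ^ 2 * C s ^ 2) ∂μ := by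
            refine integral_mono_ae (hF2 n _).integrable_sq hi ?_
            filter_upwards [hJM n ω hM] with s hs
            have h1 : F n (X n ω, τ n ω) s ^ 2 ≤ ‖J n (X n ω) s - X n ω‖ ^ 2 := by
              by_cases hsB : s ∈ B
              · simp [F, hsB, τ, h]
              · simp [F, hsB]
            have h2 := pow_le_pow_left₀ (norm_nonneg _) hs 2
            have h3 := sq_nonneg (Metric.infDist (X n ω) D - l n * (1 + M ^ p) * C s)
            nlinarith
        _ = g n ω := by
            rw [integral_add (integrable_const _) (hC.integrable_sq.const_mul _),
              integral_const_mul (2 * (l n * (1 + M ^ p)) ^ 2)]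
            simp only [integral_const, probReal_univ, smul_eq_mul, one_mul, g, τ, h, V]
            ring
  have hgi : ∀ n, Integrable (g n) P := fun n => ((hvi n).const_mul _).add (integrable_const _)
  have hgs : Summable fun n => ∫ ω, g n ω ∂P := by
    have h1 : ∀ n, ∫ ω, g n ω ∂P = 2 * ∫ ω, τ n ω * Metric.infDist (X n ω) D ^ 2 ∂P
        + l n ^ 2 * (2 * (1 + M ^ p) ^ 2 * V) := fun n => by
      simp only [g]
      rw [integral_add ((hvi n).const_mul _) (integrable_const _), integral_const_mul]
      simp
    simp_rw [h1]
    exact (hvs.mul_left 2).add (hl.mul_right _)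
  -- The conditional mean sees only innovations in B, hence the small factors μ(B) and ∫_B C.
  have hF1 : ∀ n ω, ∫ s, F n (X n ω, τ n ω) s ∂μ
      ≤ μ.real B * (τ n ω * Metric.infDist (X n ω) D)
        + (1 + M ^ p) * (∫ s in B, C s ∂μ) * l n := by
    intro n ω
    have hCi : Integrable C μ := hC.integrable one_le_two
    have hCB : 0 ≤ ∫ s in B, C s ∂μ := integral_nonneg hC0
    rw [hFeq, integral_indicator hB]
    rcases bddInd_eq (X := X) (M := M) n ω with h | ⟨h, hM⟩
    · simp only [τ, h, zero_mul, integral_zero, mul_zero, zero_add]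
      exact mul_nonneg (mul_nonneg (by positivity) hCB) (hl0 n).le
    · simp only [τ, h, one_mul]
      calc ∫ s in B, ‖J n (X n ω) s - X n ω‖ ∂μ
          ≤ ∫ s in B, (Metric.infDist (X n ω) D + l n * (1 + M ^ p) * C s) ∂μ := by
            refine integral_mono_ae ((hJ2 n _).integrable one_le_two).integrableOn
              ((integrable_const _).add (hCi.const_mul _)).integrableOn ?_
            exact ae_restrict_of_ae (hJM n ω hM)
        _ = _ := by
            rw [integral_add (integrable_const _).integrableOn (hCi.const_mul _).integrableOn,
              integral_const_mul]
            simp only [integral_const, smul_eq_mul, measureReal_restrict_apply_univ]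
            ring
  filter_upwards [ae_tendsto_sum_sub_integral (P := P) hI.measurable_innovation hI.law hI.indep
    hXτ hFm hF2 hgi hFg hgs] with ω ⟨L, hL⟩
  obtain ⟨b, hb⟩ := hL.bddAbove_range
  refine ⟨b, fun n => ?_⟩
  have hb' := hb ⟨n, rfl⟩
  simp only at hb'
  have h1 : ∀ k, τ k ω * B.indicator 1 (η k ω) * ‖X (k + 1) ω - X k ω‖
      ≤ (F k (X k ω, τ k ω) (η k ω) - ∫ s, F k (X k ω, τ k ω) s ∂μ)
        + (μ.real B * (τ k ω * Metric.infDist (X k ω) D)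
        + (1 + M ^ p) * (∫ s in B, C s ∂μ) * l k) := by
    intro k
    have h2 := hF1 k ω
    have h3 : τ k ω * B.indicator 1 (η k ω) * ‖X (k + 1) ω - X k ω‖
        = F k (X k ω, τ k ω) (η k ω) := by simp only [F, hI.step]
    linarith
  have h2 := Finset.sum_le_sum fun k (_ : k ∈ Finset.range n) => h1 k
  rw [Finset.sum_add_distrib, Finset.sum_add_distrib, ← Finset.mul_sum, ← Finset.mul_sum] at h2
  linarith

end Localization

/-! ### Truncation and the ergodic inequality -/

theorem tendsto_setIntegral_norm_gt {E H G : Type*} [MeasurableSpace E]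
    {μ : Measure E} [NormedAddCommGroup H] [MeasurableSpace H] [OpensMeasurableSpace H]
 [NormedAddCommGroup G] [NormedSpace ℝ G]
    {φ : E → H} (hφ : Measurable φ) {f : E → G} (hf : Integrable f μ) :
    Tendsto (fun c : ℕ => ∫ s in {s | (c : ℝ) < ‖φ s‖}, f s ∂μ) atTop (𝓝 0) := by
  have h1 := tendsto_setIntegral_of_antitone (μ := μ) (f := f)
    (s := fun c : ℕ => {s | (c : ℝ) < ‖φ s‖})
    (fun c => measurableSet_lt measurable_const hφ.norm)
    (fun a b hab s (hs : (b : ℝ) < ‖φ s‖) => lt_of_le_of_lt (Nat.cast_le.2 hab) hs)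
    ⟨0, hf.integrableOn⟩
  have h2 : ⋂ c : ℕ, {s | (c : ℝ) < ‖φ s‖} = ∅ := by
    ext s
    simp only [Set.mem_iInter, Set.mem_ofPred_eq, Set.mem_empty_iff_false, iff_false, not_forall,
      not_lt]
    exact exists_nat_ge _
  simpa [h2] using h1

section Ergodic

variable {Ω : Type*} [mΩ : MeasurableSpace Ω]
variable {E : Type*} [MeasurableSpace E]
variable {H : Type*} [MeasurableSpace H]
variable [NormedAddCommGroup H] [InnerProductSpace ℝ H] [BorelSpace H]
  [SecondCountableTopology H] [CompleteSpace H]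
variable {P : Measure Ω} {μ : Measure E} [IsProbabilityMeasure P] [IsProbabilityMeasure μ]
variable {ℱ : Filtration ℕ mΩ} {η : ℕ → Ω → E} {J : ℕ → H → E → H} {X : ℕ → Ω → H}

/-- Summing the proximal inequality with `φ` truncated outside the set `B` where its norm
exceeds `c`; at the times when the innovation falls in `B` the displacement is used instead. -/
theorem IsRandomIteration.sum_inner_truncation_le (hI : IsRandomIteration P μ ℱ η J X)
    {l : ℕ → ℝ} (hl : Summable fun n => l n ^ 2) {y : H} {φ : E → H}
    (hφm : Measurable φ)
    (hstep : ∀ᵐ s ∂μ, ∀ n x, ‖J n x s - y‖ ^ 2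
      ≤ ‖x - y‖ ^ 2 - 2 * l n * inner ℝ (φ s) (x - y) + l n ^ 2 * ‖φ s‖ ^ 2)
    (M : ℝ) {c : ℝ} (hc : 0 ≤ c) {B : Set E} (hB : MeasurableSet B) (hBc : ∀ s ∉ B, ‖φ s‖ ≤ c) :
    ∀ᵐ ω ∂P, (∀ k, ‖X k ω‖ ≤ M) → ∃ b, ∀ n,
      2 * ∑ k ∈ Finset.range n, l k * inner ℝ (∫ s in Bᶜ, φ s ∂μ) (X k ω - y)
        ≤ b + 2 * (M + ‖y‖) * ∑ k ∈ Finset.range n,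
          bddInd X M k ω * B.indicator 1 (η k ω) * ‖X (k + 1) ω - X k ω‖ := by
  set τ := bddInd X M
  have hτm : ∀ n, Measurable[ℱ n] (τ n) := measurable_bddInd hI.adapted
  set φc : E → H := Bᶜ.indicator φ
  have hφcm : Measurable φc := hφm.indicator hB.compl
  have hφcc : ∀ s, ‖φc s‖ ≤ c := fun s => by
    by_cases h : s ∈ B
    · simpa [φc, h] using hc
    · simpa [φc, h] using hBc s h
  have hφc2 : MemLp φc 2 μ := MemLp.of_bound hφcm.aestronglyMeasurable c (Eventually.of_forall hφcc)
  have hφci : ∫ s, φc s ∂μ = ∫ s in Bᶜ, φ s ∂μ := integral_indicator hB.compl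
  let F : ℕ → H × ℝ → E → ℝ := fun n a s => a.2 * l n * inner ℝ (φc s) (a.1 - y)
  have hFm : ∀ n, Measurable (Function.uncurry (F n)) := fun n =>
    ((measurable_snd.comp measurable_fst).mul_const (l n)).mul
      ((hφcm.comp measurable_snd).inner ((measurable_fst.comp measurable_fst).sub_const y))
  have hF2 : ∀ n a, MemLp (F n a) 2 μ := fun n a =>
    (hφc2.inner_const (a.1 - y)).const_mul (a.2 * l n)
  have hF1 : ∀ n a, ∫ s, F n a s ∂μ = a.2 * l n * inner ℝ (∫ s in Bᶜ, φ s ∂μ) (a.1 - y) := by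
    intro n a
    simp only [F]
    rw [integral_const_mul, ← hφci]
    congr 1
    simp_rw [real_inner_comm (a.1 - y)]
    exact integral_inner (hφc2.integrable one_le_two) _
  have hXτ : ∀ n, Measurable[ℱ n] fun ω => (X n ω, τ n ω) := fun n =>
    (hI.adapted n).prodMk (hτm n)
  have hFg : ∀ n ω, ∫ s, F n (X n ω, τ n ω) s ^ 2 ∂μ ≤ l n ^ 2 * (c * (M + ‖y‖)) ^ 2 := by
    intro n ω
    calc ∫ s, F n (X n ω, τ n ω) s ^ 2 ∂μ ≤ ∫ s, l n ^ 2 * (c * (M + ‖y‖)) ^ 2 ∂μ := by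
          refine integral_mono (hF2 n _).integrable_sq (integrable_const _) fun s => ?_
          rcases bddInd_eq (X := X) (M := M) n ω with h | ⟨h, hM⟩
          · simp only [F, τ, h, zero_mul, ne_eq, OfNat.ofNat_ne_zero, not_false_eq_true, zero_pow]
            positivity
          · simp only [F, τ, h, one_mul, mul_pow (l n)]
            refine mul_le_mul_of_nonneg_left ?_ (sq_nonneg _)
            rw [← sq_abs]
            refine pow_le_pow_left₀ (abs_nonneg _) ((abs_real_inner_le_norm _ _).trans ?_) 2
            refine mul_le_mul (hφcc s) ?_ (norm_nonneg _) hc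
            linarith [norm_sub_le (X n ω) y]
      _ = _ := by simp
  have hgs : Summable fun n => ∫ _, l n ^ 2 * (c * (M + ‖y‖)) ^ 2 ∂P := by
    simpa using hl.mul_right ((c * (M + ‖y‖)) ^ 2)
  filter_upwards [hI.ae_eta hstep, ae_tendsto_sum_sub_integral (P := P)
    hI.measurable_innovation hI.law hI.indep hXτ hFm hF2 (fun n => integrable_const _) hFg hgs]
    with ω hω ⟨L, hL⟩ hM
  obtain ⟨b, hb⟩ := hL.bddBelow_range
  have hτ1 : ∀ k, τ k ω = 1 := bddInd_of_forall hM
  refine ⟨‖X 0 ω - y‖ ^ 2 + c ^ 2 * ∑' k, l k ^ 2 - 2 * b, fun n => ?_⟩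
  have hb' := hb ⟨n, rfl⟩
  simp only [hF1, hτ1, one_mul] at hb'
  simp only [F, one_mul] at hb'
  rw [Finset.sum_sub_distrib] at hb'
  have h1 : ∀ k, 2 * (l k * inner ℝ (φc (η k ω)) (X k ω - y))
      ≤ (‖X k ω - y‖ ^ 2 - ‖X (k + 1) ω - y‖ ^ 2) + c ^ 2 * l k ^ 2
        + 2 * (M + ‖y‖) * (τ k ω * B.indicator 1 (η k ω) * ‖X (k + 1) ω - X k ω‖) := by
    intro k
    rw [hτ1]
    -- On B, the difference of squares is at most the displacement times the sum of the two
    -- distances to y, each at most M + ‖y‖. Off B, the proximal inequality applies with ‖φ‖ ≤ c.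
    by_cases hk : η k ω ∈ B
    · have h2 : φc (η k ω) = 0 := by simp [φc, hk]
      rw [h2, inner_zero_left, Set.indicator_of_mem hk]
      simp only [mul_zero, Pi.one_apply, one_mul]
      have h3 : ‖X (k + 1) ω - y‖ ≤ ‖X (k + 1) ω - X k ω‖ + ‖X k ω - y‖ :=
        norm_sub_le_norm_sub_add_norm_sub _ _ _
      have h4 : ∀ j, ‖X j ω - y‖ ≤ M + ‖y‖ := fun j =>
        (norm_sub_le _ _).trans (by linarith [hM j])
      have h5 := h4 k
      have h6 := h4 (k + 1)
      have h7 := norm_nonneg (X (k + 1) ω - y)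
      have h8 := norm_nonneg (X k ω - y)
      have h9 := norm_nonneg (X (k + 1) ω - X k ω)
      have h10 : ‖X (k + 1) ω - y‖ ^ 2 - ‖X k ω - y‖ ^ 2
          ≤ ‖X (k + 1) ω - X k ω‖ * (‖X (k + 1) ω - y‖ + ‖X k ω - y‖) := by nlinarith
      have h11 : ‖X (k + 1) ω - X k ω‖ * (‖X (k + 1) ω - y‖ + ‖X k ω - y‖)
          ≤ ‖X (k + 1) ω - X k ω‖ * (2 * (M + ‖y‖)) :=
        mul_le_mul_of_nonneg_left (by linarith) h9
      have h12 := mul_nonneg (sq_nonneg c) (sq_nonneg (l k))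
      linarith
    · have h2 : φc (η k ω) = φ (η k ω) := by simp [φc, hk]
      rw [h2, Set.indicator_of_notMem hk]
      have h3 := hω k k (X k ω)
      rw [← hI.step] at h3
      have h4 : ‖φ (η k ω)‖ ^ 2 ≤ c ^ 2 := pow_le_pow_left₀ (norm_nonneg _) (hBc _ hk) 2
      have h5 := mul_le_mul_of_nonneg_left h4 (sq_nonneg (l k))
      linarith
  have h2 := Finset.sum_le_sum fun k (_ : k ∈ Finset.range n) => h1 k
  rw [Finset.sum_add_distrib, Finset.sum_add_distrib, ← Finset.mul_sum, ← Finset.mul_sum,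
    ← Finset.mul_sum, Finset.sum_range_sub'] at h2
  have h3 := mul_le_mul_of_nonneg_left
    (hl.sum_le_tsum (Finset.range n) fun k _ => sq_nonneg (l k)) (sq_nonneg c)
  have h4 := sq_nonneg ‖X n ω - y‖
  linarith

/-- Ergodic estimate: on the event that the iterates are bounded, the weighted sums of
`⟪∫ φ, X k - y⟫` are asymptotically nonpositive relative to the sum of the steps. -/
theorem IsRandomIteration.sum_inner_le (hI : IsRandomIteration P μ ℱ η J X)
    {l : ℕ → ℝ} (hl0 : ∀ n, 0 < l n) (hl : Summable fun n => l n ^ 2) {D : Set H}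
    (hD : D.Nonempty) {p : ℕ} {C : E → ℝ} (hC : MemLp C 2 μ) (hC0 : ∀ s, 0 ≤ C s)
    (hJD : ∀ n a, MemLp (fun s => Metric.infDist (J n a s) D) 2 μ)
    (hJ2 : ∀ n a, MemLp (fun s => ‖J n a s - a‖) 2 μ)
    (hJC : ∀ n a, ∀ᵐ s ∂μ, ‖J n a s - a‖ ≤ Metric.infDist a D + l n * C s * (1 + ‖a‖ ^ p))
    {M r K : ℝ} (hM0 : 0 ≤ M) (hr0 : 0 ≤ r) (hr1 : r < 1) (hK : 0 < K)
    (hJ : ∀ n a, ‖a‖ ≤ M → ∫ s, Metric.infDist (J n a s) D ^ 2 ∂μ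
      ≤ (r * Metric.infDist a D) ^ 2 + (K * l n) ^ 2)
    {y : H} {φ : E → H} (hφm : Measurable φ) (hφ : Integrable φ μ)
    (hstep : ∀ᵐ s ∂μ, ∀ n x, ‖J n x s - y‖ ^ 2
      ≤ ‖x - y‖ ^ 2 - 2 * l n * inner ℝ (φ s) (x - y) + l n ^ 2 * ‖φ s‖ ^ 2) :
    ∀ᵐ ω ∂P, (∀ k, ‖X k ω‖ ≤ M) → ∀ ε > 0, ∃ b, ∀ n,
      ∑ k ∈ Finset.range n, l k * inner ℝ (∫ s, φ s ∂μ) (X k ω - y)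
        ≤ b + ε * ∑ k ∈ Finset.range n, l k := by
  obtain ⟨hvi, hvs, hdist⟩ := hI.sum_infDist_le hl0 hl hD hJD hr0 hr1 hK hJ
  let B : ℕ → Set E := fun c => {s | (c : ℝ) < ‖φ s‖}
  have hB : ∀ c, MeasurableSet (B c) := fun c => measurableSet_lt measurable_const hφm.norm
  have hdisp := ae_all_iff.2 fun c =>
    hI.sum_indicator_displacement_le hl0 hl hC hC0 hJ2 hJC hM0 hvi hvs (hB c)
  have htr := ae_all_iff.2 fun c : ℕ => hI.sum_inner_truncation_le hl hφm hstep M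
    (Nat.cast_nonneg c) (hB c) fun s hs => not_lt.1 hs
  filter_upwards [hdist, hdisp, htr] with ω ⟨b₁, hb₁⟩ hdisp htr hM ε hε
  set R := M + ‖y‖
  have hR : 0 ≤ R := by positivity
  -- The total coefficient of ∑ l_k caused by truncating at level c: the lost mean of φ plus the
  -- displacement on `B c`. It vanishes because the sets `B c` decrease to ∅.
  set δ : ℕ → ℝ := fun c => ‖∫ s in B c, φ s ∂μ‖ * R
    + R * (μ.real (B c) * (K / (1 - r)) + (1 + M ^ p) * ∫ s in B c, C s ∂μ)
  have hδ : Tendsto δ atTop (𝓝 0) := by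
    have h1 := tendsto_setIntegral_norm_gt (μ := μ) hφm hφ
    have h2 := tendsto_setIntegral_norm_gt (μ := μ) hφm (hC.integrable one_le_two)
    have h3 := tendsto_setIntegral_norm_gt (μ := μ) hφm (integrable_const (1 : ℝ))
    simp only [integral_const, smul_eq_mul, mul_one, measureReal_restrict_apply_univ] at h3
    have h4 := (h1.norm.mul_const R).add
      (((h3.mul_const (K / (1 - r))).add (h2.const_mul (1 + M ^ p))).const_mul R)
    simpa using h4
  obtain ⟨c, hc⟩ := (hδ.eventually_lt_const hε).exists
  obtain ⟨b₂, hb₂⟩ := hdisp c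
  obtain ⟨b₃, hb₃⟩ := htr c hM
  refine ⟨b₃ / 2 + R * (b₂ + μ.real (B c) * b₁), fun n => ?_⟩
  set W := ∑ k ∈ Finset.range n, l k
  have hW : 0 ≤ W := Finset.sum_nonneg fun k _ => (hl0 k).le
  have h1 := mul_le_mul_of_nonneg_left (hb₁ n) (measureReal_nonneg (μ := μ) (s := B c))
  have h2 := mul_le_mul_of_nonneg_left ((hb₂ n).trans (add_le_add_left (add_le_add_right h1 _) _)) hR
  have h3 := hb₃ n
  have h4 : ∑ k ∈ Finset.range n, l k * inner ℝ (∫ s, φ s ∂μ) (X k ω - y)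
      ≤ ∑ k ∈ Finset.range n, l k * inner ℝ (∫ s in (B c)ᶜ, φ s ∂μ) (X k ω - y)
        + ‖∫ s in B c, φ s ∂μ‖ * R * W := by
    rw [Finset.mul_sum, ← Finset.sum_add_distrib]
    refine Finset.sum_le_sum fun k _ => ?_
    rw [← integral_add_compl (hB c) hφ, inner_add_left]
    have h5 : inner ℝ (∫ s in B c, φ s ∂μ) (X k ω - y) ≤ ‖∫ s in B c, φ s ∂μ‖ * R := by
      refine (real_inner_le_norm _ _).trans (mul_le_mul_of_nonneg_left ?_ (norm_nonneg _))
      exact (norm_sub_le _ _).trans (by simp only [R]; linarith [hM k])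
    nlinarith [hl0 k]
  have h5 : δ c * W ≤ ε * W := mul_le_mul_of_nonneg_right hc.le hW
  simp only [δ] at h5
  linarith

end Ergodic

/-! ### Weighted averages and the ergodic Opial lemma -/

section Opial

variable {H : Type*} [NormedAddCommGroup H] [InnerProductSpace ℝ H]

theorem sum_Icc_one_eq_sum_range {G : Type*} [AddCommMonoid G] (f : ℕ → G) (n : ℕ) :
    ∑ k ∈ Finset.Icc 1 n, f k = ∑ k ∈ Finset.range n, f (k + 1) := by
  induction n with
  | zero => simp
  | succ n ih => rw [Finset.sum_Icc_succ_top (by omega), Finset.sum_range_succ, ih]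

theorem tendsto_sum_Icc_atTop {l : ℕ → ℝ} (hl0 : ∀ n, 0 < l n) (hl : ¬ Summable l) :
    Tendsto (fun n => ∑ k ∈ Finset.Icc 1 n, l k) atTop atTop := by
  simp_rw [sum_Icc_one_eq_sum_range]
  exact (not_summable_iff_tendsto_nat_atTop_of_nonneg fun n => (hl0 (n + 1)).le).1
    fun h => hl ((summable_nat_add_iff 1).1 h)

theorem sum_Icc_pos {l : ℕ → ℝ} (hl0 : ∀ n, 0 < l n) {n : ℕ} (hn : 1 ≤ n) :
    0 < ∑ k ∈ Finset.Icc 1 n, l k :=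
  Finset.sum_pos (fun k _ => hl0 k) ⟨1, Finset.mem_Icc.2 ⟨le_rfl, hn⟩⟩

theorem inner_weightedAvg (l : ℕ → ℝ) (x : ℕ → H) (n : ℕ) (y : H) :
    inner ℝ (weightedAvg l x n) y = weightedAvg l (fun k => inner ℝ (x k) y) n := by
  simp only [weightedAvg, real_inner_smul_left, sum_inner, smul_eq_mul]

/-- A Cesàro–Toeplitz argument: the weighted deviations are o(l_k), and the sum of the weights
diverges. -/
theorem tendsto_weightedAvg {l : ℕ → ℝ} (hl0 : ∀ n, 0 < l n) (hl : ¬ Summable l)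
    {a : ℕ → ℝ} {L : ℝ} (ha : Tendsto a atTop (𝓝 L)) :
    Tendsto (weightedAvg l a) atTop (𝓝 L) := by
  have h1 : (fun k => l (k + 1) * (a (k + 1) - L)) =o[atTop] fun k => l (k + 1) := by
    refine Asymptotics.isLittleO_of_tendsto (fun k hk => absurd hk (hl0 _).ne') ?_
    have h2 : Tendsto (fun k => a (k + 1) - L) atTop (𝓝 0) := by
      simpa using ((tendsto_add_atTop_iff_nat 1).2 ha).sub_const L
    refine h2.congr fun k => ?_
    rw [mul_div_cancel_left₀ _ (hl0 _).ne']
  have hW := tendsto_sum_Icc_atTop hl0 hl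
  simp_rw [sum_Icc_one_eq_sum_range] at hW
  have h2 := (h1.sum_range (fun k => (hl0 _).le) hW).tendsto_div_nhds_zero
  have h3 := h2.add_const L
  rw [zero_add] at h3
  refine h3.congr' ?_
  filter_upwards [eventually_ge_atTop 1] with n hn
  have hp := sum_Icc_pos hl0 hn
  simp only [weightedAvg, sum_Icc_one_eq_sum_range, smul_eq_mul] at hp ⊢
  simp only [mul_sub, Finset.sum_sub_distrib, ← Finset.sum_mul]
  field_simp
  ring

theorem norm_weightedAvg_le {l : ℕ → ℝ} (hl0 : ∀ n, 0 < l n) {x : ℕ → H} {R : ℝ}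
    (hx : ∀ n, ‖x n‖ ≤ R) {n : ℕ} (hn : 1 ≤ n) : ‖weightedAvg l x n‖ ≤ R := by
  have hp := sum_Icc_pos hl0 hn
  rw [weightedAvg, norm_smul, Real.norm_eq_abs, abs_of_pos (inv_pos.2 hp), inv_mul_le_iff₀ hp,
    Finset.sum_mul]
  refine norm_sum_le_of_le _ fun k _ => ?_
  rw [norm_smul, Real.norm_eq_abs, abs_of_pos (hl0 k)]
  exact mul_le_mul_of_nonneg_left (hx k) (hl0 k).le

-- The maps z ↦ ‖x n - z‖ are 1-Lipschitz uniformly in n. An almost sure statement on a countable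
-- dense set of zeros thereby reaches all zeros.
omit [InnerProductSpace ℝ H] in
theorem exists_tendsto_norm_sub_of_mem_closure {x : ℕ → H} {S : Set H}
    (hS : ∀ z ∈ S, ∃ L, Tendsto (fun n => ‖x n - z‖) atTop (𝓝 L)) {z : H} (hz : z ∈ closure S) :
    ∃ L, Tendsto (fun n => ‖x n - z‖) atTop (𝓝 L) := by
  refine cauchySeq_tendsto_of_complete (Metric.cauchySeq_iff'.2 fun ε hε => ?_)
  obtain ⟨z', hz', hzz⟩ := Metric.mem_closure_iff.1 hz (ε / 3) (by linarith)
  obtain ⟨L, hL⟩ := hS z' hz'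
  obtain ⟨N, hN⟩ := Metric.cauchySeq_iff'.1 hL.cauchySeq (ε / 3) (by linarith)
  refine ⟨N, fun n hn => ?_⟩
  have h1 := hN n hn
  rw [dist_eq_norm] at hzz
  have h2 : ∀ m, |‖x m - z‖ - ‖x m - z'‖| ≤ ‖z - z'‖ := fun m => by
    refine (abs_norm_sub_norm_le _ _).trans_eq ?_
    rw [sub_sub_sub_cancel_left, norm_sub_rev]
  have h3 := abs_le.1 (h2 n)
  have h4 := abs_le.1 (h2 N)
  rw [Real.dist_eq, abs_lt] at h1 ⊢
  constructor <;> linarith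

theorem tendsto_toWeakSpace_iff [CompleteSpace H] {ι : Type*} {f : Filter ι} {x : ι → H} {z : H} :
    Tendsto (fun i => toWeakSpace ℝ H (x i)) f (𝓝 (toWeakSpace ℝ H z)) ↔
      ∀ y, Tendsto (fun i => inner ℝ (x i) y) f (𝓝 (inner ℝ z y)) := by
  have hinj : Function.Injective (topDualPairing ℝ H).flip := fun a b hab =>
    ext_inner_left ℝ fun y => by
      simpa using LinearMap.congr_fun hab (InnerProductSpace.toDual ℝ H y)
  refine (WeakBilin.tendsto_iff_forall_eval_tendsto (B := (topDualPairing ℝ H).flip) hinj).trans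
    ⟨fun h y => ?_, fun h g => ?_⟩
  · have h1 : ∀ w : H, inner ℝ w y = InnerProductSpace.toDual ℝ H y w := fun w =>
      real_inner_comm y w
    simp_rw [h1]
    exact h (InnerProductSpace.toDual ℝ H y)
  · have h1 : ∀ w : H, g w = inner ℝ w ((InnerProductSpace.toDual ℝ H).symm g) := fun w => by
      rw [real_inner_comm, InnerProductSpace.toDual_symm_apply]
    have h2 := h ((InnerProductSpace.toDual ℝ H).symm g)
    simp_rw [← h1] at h2
    exact h2

/-- Ergodic form of Opial's lemma for a maximal monotone operator: weighted averages of a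
sequence that is Fejér with respect to the zeroes, and satisfies the ergodic inequality on a
dense part of the graph, converge weakly to a zero. -/
theorem IsMaximalMonotoneOp.exists_tendsto_weightedAvg [CompleteSpace H] {T : H → Set H}
    (hT : IsMaximalMonotoneOp T) (hne : (zer T).Nonempty) {l : ℕ → ℝ} (hl0 : ∀ n, 0 < l n)
    (hl : ¬ Summable l) {x : ℕ → H} {S : Set H} (hS : zer T ⊆ closure S)
    (hfejer : ∀ z ∈ S, ∃ L, Tendsto (fun n => ‖x n - z‖) atTop (𝓝 L))
    {G : Set (H × H)} (hG : {q : H × H | q.2 ∈ T q.1} ⊆ closure G)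
    (herg : ∀ q ∈ G, ∀ ε > 0, ∃ b, ∀ n, ∑ k ∈ Finset.range n, l k * inner ℝ q.2 (x k - q.1)
      ≤ b + ε * ∑ k ∈ Finset.range n, l k) :
    ∃ z ∈ zer T, Tendsto (fun n => toWeakSpace ℝ H (weightedAvg l x n)) atTop
      (𝓝 (toWeakSpace ℝ H z)) := by
  have hfej : ∀ z ∈ zer T, ∃ L, Tendsto (fun n => ‖x n - z‖) atTop (𝓝 L) := fun z hz =>
    exists_tendsto_norm_sub_of_mem_closure hfejer (hS hz)
  obtain ⟨R, hR⟩ : ∃ R, ∀ n, ‖x n‖ ≤ R := by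
    obtain ⟨z, hz⟩ := hne
    obtain ⟨L, hL⟩ := hfej z hz
    obtain ⟨B, hB⟩ := hL.bddAbove_range
    refine ⟨B + ‖z‖, fun n => ?_⟩
    have h1 : ‖x n - z‖ ≤ B := hB ⟨n, rfl⟩
    linarith [norm_le_norm_sub_add (x n) z]
  have hbd : ∀ᶠ n in atTop, ‖weightedAvg l x n‖ ≤ R := by
    filter_upwards [eventually_ge_atTop 1] with n hn using norm_weightedAvg_le hl0 hR hn
  have hlim : ∀ U : Ultrafilter ℕ, (U : Filter ℕ) ≤ atTop → ∃ z ∈ zer T, ∀ y,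
      Tendsto (fun n => inner ℝ (weightedAvg l x n) y) U (𝓝 (inner ℝ z y)) := by
    intro U hU
    obtain ⟨z, hz⟩ := exists_weakLimit_of_bounded U (weightedAvg l x) R (hU hbd)
    refine ⟨z, hT.mem_of_forall fun u v hv => ?_, hz⟩
    have hcl : IsClosed {q : H × H | inner ℝ q.2 (z - q.1) ≤ 0} :=
      isClosed_le (by fun_prop) continuous_const
    have hGle : G ⊆ {q : H × H | inner ℝ q.2 (z - q.1) ≤ 0} := by
      intro q hq
      change inner ℝ q.2 (z - q.1) ≤ 0
      refine le_of_forall_pos_le_add fun ε hε => ?_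
      obtain ⟨b, hb⟩ := herg q hq ε hε
      -- The averages start at k = 1 and the ergodic sums at k = 0; `b'` absorbs the extra term.
      set b' := b + ε * l 0 - l 0 * inner ℝ q.2 (x 0 - q.1)
      have h1 : ∀ᶠ n in atTop, inner ℝ (weightedAvg l x n) q.2 - inner ℝ q.1 q.2
          ≤ b' / ∑ k ∈ Finset.Icc 1 n, l k + ε := by
        filter_upwards [eventually_ge_atTop 1] with n hn
        have hp := sum_Icc_pos hl0 hn
        have h2 := hb (n + 1)
        rw [Finset.sum_range_succ', Finset.sum_range_succ' l,
          ← sum_Icc_one_eq_sum_range (fun k => l k * inner ℝ q.2 (x k - q.1)),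
          ← sum_Icc_one_eq_sum_range] at h2
        rw [inner_weightedAvg, ← sub_le_iff_le_add, le_div_iff₀ hp]
        simp only [weightedAvg, smul_eq_mul]
        have h3 : ∑ k ∈ Finset.Icc 1 n, l k * inner ℝ q.2 (x k - q.1)
            = ∑ k ∈ Finset.Icc 1 n, l k * inner ℝ (x k) q.2
              - (∑ k ∈ Finset.Icc 1 n, l k) * inner ℝ q.1 q.2 := by
          rw [Finset.sum_mul, ← Finset.sum_sub_distrib]
          refine Finset.sum_congr rfl fun k _ => ?_
          rw [inner_sub_right, real_inner_comm (x k), real_inner_comm q.1]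
          ring
        rw [h3] at h2
        have h4 : ((∑ k ∈ Finset.Icc 1 n, l k)⁻¹ * ∑ k ∈ Finset.Icc 1 n, l k * inner ℝ (x k) q.2
            - inner ℝ q.1 q.2 - ε) * ∑ k ∈ Finset.Icc 1 n, l k
            = ∑ k ∈ Finset.Icc 1 n, l k * inner ℝ (x k) q.2
              - (∑ k ∈ Finset.Icc 1 n, l k) * inner ℝ q.1 q.2
              - ε * ∑ k ∈ Finset.Icc 1 n, l k := by
          field_simp
        rw [h4]
        simp only [b']
        linarith
      have h2 : Tendsto (fun n => b' / ∑ k ∈ Finset.Icc 1 n, l k + ε) U (𝓝 (0 + ε)) :=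
        (((tendsto_sum_Icc_atTop hl0 hl).const_div_atTop b').add_const ε).mono_left hU
      have h3 := le_of_tendsto_of_tendsto ((hz q.2).sub_const _) h2 (hU h1)
      rw [inner_sub_right, real_inner_comm z, real_inner_comm q.1]
      exact h3
    have h1 : inner ℝ v (z - u) ≤ 0 := closure_minimal hGle hcl (hG (show (u, v) ∈ _ from hv))
    rw [zero_sub, inner_neg_left]
    linarith
  obtain ⟨z, hz, hzU⟩ := hlim (Ultrafilter.of atTop) (Ultrafilter.of_le _)
  refine ⟨z, hz, tendsto_toWeakSpace_iff.2 fun y => tendsto_iff_ultrafilter _ _ _ |>.2 fun V hV => ?_⟩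
  obtain ⟨z', hz', hzV⟩ := hlim V hV
  have hzz : z = z' := by
    obtain ⟨L, hL⟩ := hfej z hz
    obtain ⟨L', hL'⟩ := hfej z' hz'
    -- Opial's step: this inner product is an affine function of two convergent squared distances.
    -- Its averages have the same limit, so z and z' have equal inner products with z - z'.
    have h1 : Tendsto (fun n => inner ℝ (x n) (z - z')) atTop
        (𝓝 ((L' ^ 2 - L ^ 2 + ‖z‖ ^ 2 - ‖z'‖ ^ 2) / 2)) := by
      refine (((((hL'.pow 2).sub (hL.pow 2)).add_const _).sub_const _).div_const 2).congr
        fun n => ?_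
      rw [norm_sub_sq_real, norm_sub_sq_real, inner_sub_right]
      ring
    have h2 := tendsto_weightedAvg hl0 hl h1
    have h3 : Tendsto (fun n => inner ℝ (weightedAvg l x n) (z - z')) atTop
        (𝓝 ((L' ^ 2 - L ^ 2 + ‖z‖ ^ 2 - ‖z'‖ ^ 2) / 2)) :=
      h2.congr fun n => (inner_weightedAvg l x n _).symm
    have h4 := tendsto_nhds_unique (hzU (z - z')) (h3.mono_left (Ultrafilter.of_le _))
    have h5 := tendsto_nhds_unique (hzV (z - z')) (h3.mono_left hV)
    rw [← sub_eq_zero, ← inner_self_eq_zero (𝕜 := ℝ), inner_sub_left, h4, h5, sub_self]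
  rw [hzz]
  exact hzV y

end Opial

/-! ### Construction of the random iteration and the main theorem -/

section Main

variable {Ω : Type*} [mΩ : MeasurableSpace Ω]
variable {E : Type*} [mE : MeasurableSpace E]
variable {H : Type*}

/-- The filtration generated by a sequence of random variables, up to strictly before `n`. -/
def pastFiltration (η : ℕ → Ω → E) (hη : ∀ n, Measurable (η n)) : Filtration ℕ mΩ where
  seq n := ⨆ i ∈ Set.Iio n, MeasurableSpace.comap (η i) mE
  mono' _ _ h := biSup_mono fun _ hi => lt_of_lt_of_le hi h
  le' _ := iSup₂_le fun i _ => (hη i).comap_le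

/-- The iterates of the maps `J n` started at `x₀` and driven by the innovations `η n`. -/
def randomIter (J : ℕ → H → E → H) (η : ℕ → Ω → E) (x₀ : H) : ℕ → Ω → H
  | 0, _ => x₀
  | n + 1, ω => J n (randomIter J η x₀ n ω) (η n ω)

/-- The n-th iterate depends only on η 0, …, η (n - 1), a block of indices disjoint from {n}. -/
theorem isRandomIteration_randomIter [MeasurableSpace H] {P : Measure Ω} {μ : Measure E}
    {η : ℕ → Ω → E} (hη : ∀ n, Measurable (η n)) (hlaw : ∀ n, P.map (η n) = μ)
    (hind : iIndepFun η P) {J : ℕ → H → E → H} (hJ : ∀ n, Measurable (Function.uncurry (J n)))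
    (x₀ : H) :
    IsRandomIteration P μ (pastFiltration η hη) η J (randomIter J η x₀) where
  measurable_innovation n := Measurable.of_comap_le
    (le_iSup₂_of_le (f := fun i (_ : i ∈ Set.Iio (n + 1)) => MeasurableSpace.comap (η i) mE)
      n (Set.mem_Iio.2 n.lt_succ_self) le_rfl)
  law := hlaw
  indep n := by
    have h := indep_iSup_of_disjoint (fun i => (hη i).comap_le) hind
      (S := Set.Iio n) (T := {n}) (by simp)
    simp only [Set.mem_singleton_iff, iSup_iSup_eq_left] at h
    exact h
  measurable_map := hJ
  adapted n := by
    induction n with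
    | zero => exact measurable_const
    | succ n ih =>
      refine (hJ n).comp ((ih.mono ((pastFiltration η hη).mono n.le_succ) le_rfl).prodMk ?_)
      exact Measurable.of_comap_le
        (le_iSup₂_of_le (f := fun i (_ : i ∈ Set.Iio (n + 1)) => MeasurableSpace.comap (η i) mE)
          n (Set.mem_Iio.2 n.lt_succ_self) le_rfl)
  start := ⟨x₀, fun _ => rfl⟩
  step _ _ := rfl

variable [NormedAddCommGroup H] [InnerProductSpace ℝ H] [CompleteSpace H]

/-- The exceptional set depends on neither n nor x, so the inequality may be evaluated at a random
iterate. -/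
theorem ae_safeResolvent_step {μ : Measure E} {A : E → H → Set H}
    (hA_max : ∀ᵐ s ∂μ, IsMaximalMonotoneOp (A s)) {l : ℕ → ℝ} (hl : ∀ n, 0 < l n) {y : H}
    {φ : E → H} (hφ : ∀ᵐ s ∂μ, φ s ∈ A s y) :
    ∀ᵐ s ∂μ, ∀ n x, ‖safeResolvent A (l n) x s - y‖ ^ 2
      ≤ ‖x - y‖ ^ 2 - 2 * l n * inner ℝ (φ s) (x - y) + l n ^ 2 * ‖φ s‖ ^ 2 := by
  filter_upwards [hA_max, hφ] with s hs hφs n x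
  rw [safeResolvent_eq hs]
  exact hs.norm_resolvent_sub_sq_le (hl n) x hφs

end Main

end StochProx

theorem mainTheorem1
    {E : Type*} [MeasurableSpace E] (μ : Measure E) [IsProbabilityMeasure μ] [μ.IsComplete]
    {H : Type*} [NormedAddCommGroup H] [InnerProductSpace ℝ H] [CompleteSpace H]
    [TopologicalSpace.SeparableSpace H] [MeasurableSpace H] [BorelSpace H]
    {Ω : Type*} [MeasurableSpace Ω] (P : Measure Ω) [IsProbabilityMeasure P]
    (A : E → H → Set H)
    -- the operators are maximal monotone and depend measurably on `s`
    (hA_max : ∀ᵐ s ∂μ, StochProx.IsMaximalMonotoneOp (A s))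
    (hA_meas : ∀ l : ℝ, 0 < l → ∀ x : H, Measurable fun s => StochProx.resolvent (A s) l x)
    -- the step sizes are positive, in `ℓ² \ ℓ¹`, with ratios tending to `1`
    (l : ℕ → ℝ) (hl_pos : ∀ n, 0 < l n) (hl_sq : Summable fun n => l n ^ 2)
    (hl_one : ¬ Summable l) (hl_ratio : Tendsto (fun n => l n / l (n + 1)) atTop (𝓝 1))
    -- `ξ₁, ξ₂, …` are independent with law `μ` (the index `0` is not used)
    (ξ : ℕ → Ω → E) (hξ_meas : ∀ n, Measurable (ξ (n + 1)))
    (hξ_law : ∀ n, P.map (ξ (n + 1)) = μ) (hξ_indep : iIndepFun (fun n => ξ (n + 1)) P)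
    (x₀ : H)
    -- the mean operator is maximal
    (h_mean : StochProx.IsMaximalMonotoneOp (StochProx.meanOp μ A))
    -- it has zeroes, and all of them have square-integrable zero-mean selections
    (h_zer : (StochProx.zer (StochProx.meanOp μ A)).Nonempty)
    (h_zer_sq : StochProx.zer (StochProx.meanOp μ A) ⊆ StochProx.zeroMeanSet μ A 2)
    -- uniform integrability of the least-norm sections on bounded sets
    (h_ui : ∀ K : Set H, Bornology.IsBounded K →
      UniformIntegrable
        (fun (x : ↥(K ∩ StochProx.essDom μ A)) (s : E) =>
          ‖StochProx.leastNorm (A s) (x : H)‖) 1 μ)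
    -- bounded linear regularity of the domains
    (h_reg : ∀ M : ℝ, 0 < M → ∃ κ : ℝ, 0 < κ ∧ ∀ x : H, ‖x‖ ≤ M →
      ENNReal.ofReal κ * Metric.infEDist x (StochProx.essDom μ A) ^ 2 ≤
        ∫⁻ s, Metric.infEDist x (StochProx.opDom (A s)) ^ 2 ∂μ)
    -- the resolvents are `O(l)`-close to the projections onto the closures of the domains
    (h_res : ∃ (p : ℕ) (C : E → ℝ), 1 ≤ p ∧ MemLp C 2 μ ∧ (∀ s, 0 ≤ C s) ∧
      (∀ (x : H) (t : ℝ), 0 < t → ∀ᵐ s ∂μ,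
        ‖StochProx.resolvent (A s) t x -
            StochProx.proj (closure (StochProx.opDom (A s))) x‖ ≤ t * C s * (1 + ‖x‖ ^ p)) ∧
      (StochProx.zeroMeanSet μ A ((2 * p : ℕ) : ℝ≥0∞)).Nonempty) :
    ∀ᵐ ω ∂P, ∃ z ∈ StochProx.zer (StochProx.meanOp μ A),
      Tendsto
        (fun n => toWeakSpace ℝ H
          (StochProx.weightedAvg l (fun k => StochProx.proxIter A l ξ x₀ k ω) n))
        atTop (𝓝 (toWeakSpace ℝ H z)) := by 
  have : SecondCountableTopology H := UniformSpace.secondCountable_of_separable H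
  obtain ⟨p, C, -, hC, hC0, hres, -⟩ := h_res
  set D := StochProx.essDom μ A
  have hD : D.Nonempty := by
    obtain ⟨z, φ, hφ, -⟩ := h_zer
    exact ⟨z, hφ.2.mono fun s hs => ⟨_, hs⟩⟩
  let J : ℕ → H → E → H := fun n => StochProx.safeResolvent A (l n)
  let X := StochProx.randomIter J (fun n => ξ (n + 1)) x₀
  have hI := StochProx.isRandomIteration_randomIter (P := P) (μ := μ) (J := J) hξ_meas hξ_law
    hξ_indep (fun n => StochProx.measurable_uncurry_safeResolvent hA_max (hl_pos n)
      (hA_meas _ (hl_pos n))) x₀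
  obtain ⟨S, hSsub, hSc, hS⟩ := (TopologicalSpace.IsSeparable.of_separableSpace
    (StochProx.zer (StochProx.meanOp μ A))).exists_countable_dense_subset
  obtain ⟨G, hGsub, hGc, hG⟩ := (TopologicalSpace.IsSeparable.of_separableSpace
    {q : H × H | q.2 ∈ StochProx.meanOp μ A q.1}).exists_countable_dense_subset
  have hfejer : ∀ᵐ ω ∂P, ∀ z ∈ S, ∃ L, Tendsto (fun n => ‖X n ω - z‖) atTop (𝓝 L) := by
    refine (ae_ball_iff hSc).2 fun z hz => ?_
    obtain ⟨φ, hφ, hφ2, hφ0⟩ := h_zer_sq (hSsub hz)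
    exact hI.ae_tendsto_norm_sub hl_sq hφ.1 hφ2 hφ0
      (StochProx.ae_safeResolvent_step hA_max hl_pos hφ.2)
  -- Integer radii keep the union of exceptional sets countable, since the bound on the trajectory
  -- depends on ω; adding 1 makes the radius positive.
  have herg : ∀ᵐ ω ∂P, ∀ M : ℕ, ∀ q ∈ G, (∀ k, ‖X k ω‖ ≤ (M : ℝ) + 1) → ∀ ε > 0, ∃ b, ∀ n,
      ∑ k ∈ Finset.range n, l k * inner ℝ q.2 (X k ω - q.1)
        ≤ b + ε * ∑ k ∈ Finset.range n, l k := by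
    refine ae_all_iff.2 fun M => (ae_ball_iff hGc).2 fun q hq => ?_
    obtain ⟨φ, hφ, hφi, hφq⟩ := hGsub hq
    obtain ⟨κ, hκ, hreg⟩ := h_reg ((M : ℝ) + 1) (by positivity)
    obtain ⟨r, K, hr0, hr1, hK, hJ⟩ := StochProx.exists_integral_infDist_sq_le hA_max hA_meas hC
      hres hD hκ hreg
    have h := hI.sum_inner_le hl_pos hl_sq hD hC hC0
      (fun n a => StochProx.memLp_infDist_safeResolvent hA_max hA_meas hC hres hD a (hl_pos n))
      (fun n a => StochProx.memLp_norm_safeResolvent_sub hA_max hA_meas hC hres hD a a (hl_pos n))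
      (fun n a => StochProx.norm_safeResolvent_sub_self_le hA_max hA_meas hres hD a (hl_pos n))
      (by positivity) hr0 hr1 hK (fun n a ha => hJ a ha (l n) (hl_pos n)) hφ.1 hφi
      (StochProx.ae_safeResolvent_step hA_max hl_pos hφ.2)
    rwa [hφq] at h
  filter_upwards [hfejer, herg, hI.ae_eta hA_max] with ω hω1 hω2 hω3
  -- Almost surely every innovation avoids the bad set, so the modified and the original iterations
  -- coincide.
  have hX : ∀ n, StochProx.proxIter A l ξ x₀ n ω = X n ω := by
    intro n
    induction n with
    | zero => rfl
    | succ n ih =>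
      change StochProx.resolvent (A (ξ (n + 1) ω)) (l n) (StochProx.proxIter A l ξ x₀ n ω)
        = StochProx.safeResolvent A (l n) (X n ω) (ξ (n + 1) ω)
      rw [StochProx.safeResolvent_eq (hω3 n), ih]
  simp_rw [hX]
  refine h_mean.exists_tendsto_weightedAvg h_zer hl_pos hl_one hS hω1 hG ?_
  obtain ⟨M, hM⟩ : ∃ M : ℕ, ∀ k, ‖X k ω‖ ≤ (M : ℝ) + 1 := by
    obtain ⟨z, hz⟩ := h_zer
    obtain ⟨L, hL⟩ := StochProx.exists_tendsto_norm_sub_of_mem_closure hω1 (hS hz)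
    obtain ⟨B, hB⟩ := hL.bddAbove_range
    obtain ⟨M, hM⟩ := exists_nat_ge (B + ‖z‖)
    refine ⟨M, fun n => ?_⟩
    have h1 : ‖X n ω - z‖ ≤ B := hB ⟨n, rfl⟩
    linarith [norm_le_norm_sub_add (X n ω) z]
  exact fun q hq => hω2 M q hq hM
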